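/- Let $(M,g)$ be a smooth compact connected Riemannian manifold of dimension $n$ with Levi-Civita connection $\nabla$, and let $F_O(M)$ be its orthonormal frame bundle, whose points over $x\in M$ are the linear isometries $u:\mathbb R^n\to T_xM$; write $\pi(u)=x$. For $w\in T_{\pi(u)}M$ let $w^h\in T_uF_O(M)$ be its horizontal lift, and let $H_\alpha(u)=(u e_\alpha)^h$ for the standard basis $e_\alpha$ of $\mathbb R^n$. The horizontal lift of a vector field $Y$ on $M$ is $Y^h(u)=(Y(\pi(u)))^h$. Repeated indices are summed. Let $\gamma,\sigma$ be smooth $\binom11$-tensor fields on $M$, and suppose that for some $\gamma_1>0$ all eigenvalues of $\frac12(\gamma+\gamma^T)$ are at least $\gamma_1$ at every point of $M$. Define matrix-valued functions on $F_O(M)$ by $\gamma(u)=u^{-1}\gamma(\pi(u))u$ and $\sigma(u)=u^{-1}\sigma(\pi(u))u$, and put, with components in the standard basis of $\mathbb R^n$, $$\Sigma^{\mu\nu}(u)=\sum_\delta\sigma^\mu_\delta(u)\sigma^\nu_\delta(u),\qquad J^{\beta\alpha}(u)=\int_0^\infty (e^{-y\gamma(u)})^\beta_\mu (e^{-y\gamma(u)})^\alpha_\nu\,dy\;\Sigma^{\mu\nu}(u).$$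 The (horizontal) noise-induced drift is the vector field on $F_O(M)$ $$S^h=-\tfrac12\sum_\alpha(\gamma^{-1})^\eta_\mu\sigma^\mu_\alpha(\gamma^{-1})^\xi_\nu\, H_\eta[\sigma^\nu_\alpha]\,H_\xi-\tfrac12\left((\gamma^{-1})^\eta_\mu J^{\mu\chi}\gamma^\nu_\chi-J^{\eta\nu}\right)H_\eta[(\gamma^{-1})^\xi_\nu]\,H_\xi ,$$ where all functions are evaluated at $u\in F_O(M)$ and $H_\eta[f]$ is the derivative of $f$ along $H_\eta$. Define on $M$ the tensor fields $$\Sigma^{\xi\eta}=\sigma^\xi_\alpha g^{\alpha\beta}\sigma^\eta_\beta,\qquad J^{\mu\nu}=\int_0^\infty (e^{-y\gamma})^\mu_\delta\,\Sigma^{\delta\eta}\,(e^{-y\gamma})^\nu_\eta\,dy,\qquad L^{\mu\nu}=\int_0^\infty(\gamma^{-1}e^{-y\gamma})^\mu_\alpha\,\Sigma^{\alpha\beta}\,(\gamma e^{-y\gamma})^\nu_\beta\,dy .$$ Then the integrals converge absolutely, $\Sigma,J,L$ are smooth tensor fields on $M$, the formula $$Y^\chi=-\tfrac12\, g^{\nu\rho}(\gamma^{-1}\sigma)^\beta_\nu(\gamma^{-1})^\chi_\delta\,\nabla_\beta\sigma^\delta_\rho-\tfrac12\,(L^{\beta\rho}-J^{\beta\rho})\,\nabla_\beta(\gamma^{-1})^\chi_\rho$$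 (components in an arbitrary basis of the tangent space) defines a smooth vector field $Y$ on $M$, and $S^h$ is the horizontal lift of $Y$: $S^h(u)=Y^h(u)$ for every $u\in F_O(M)$. -/

import Mathlib

open Bundle Manifold MeasureTheory
open scoped ContDiff

noncomputable section

namespace NoiseDrift

/-- Coordinate space `ℝⁿ` with its Euclidean inner product. -/
abbrev Euc (n : ℕ) : Type := EuclideanSpace ℝ (Fin n)

/-- The standard basis vector `e_i` of `ℝⁿ`. -/
def stdVec {n : ℕ} (i : Fin n) : Euc n := EuclideanSpace.single i (1 : ℝ)

instance instFiniteDimensionalTangent {n : ℕ} {M : Type*} [TopologicalSpace M]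
    [ChartedSpace (Euc n) M] (x : M) : FiniteDimensional ℝ (TangentSpace (𝓡 n) x) :=
  inferInstanceAs (FiniteDimensional ℝ (Euc n))

instance instT2SpaceTangent {n : ℕ} {M : Type*} [TopologicalSpace M]
    [ChartedSpace (Euc n) M] (x : M) : T2Space (TangentSpace (𝓡 n) x) :=
  inferInstanceAs (T2Space (Euc n))

instance instIsTopologicalRingTangentEnd {n : ℕ} {M : Type*} [TopologicalSpace M]
    [ChartedSpace (Euc n) M] (x : M) :
    IsTopologicalRing (TangentSpace (𝓡 n) x →L[ℝ] TangentSpace (𝓡 n) x) :=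
  inferInstanceAs (IsTopologicalRing (Euc n →L[ℝ] Euc n))

/-! ### Smooth tensor fields -/

section Tensors

variable {n : ℕ} {M : Type*} [TopologicalSpace M] [ChartedSpace (Euc n) M] [IsManifold (𝓡 n) ∞ M]

/-- `Y` is a smooth vector field on `M`. -/
def SmoothVectorField (Y : ∀ x : M, TangentSpace (𝓡 n) x) : Prop :=
  ContMDiff (𝓡 n) ((𝓡 n).prod 𝓘(ℝ, Euc n)) ∞
    (fun x ↦ TotalSpace.mk' (Euc n) (E := fun x : M ↦ TangentSpace (𝓡 n) x) x (Y x))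

/-- `A` is a smooth `(1,1)`-tensor field on `M`, i.e. a smooth field of endomorphisms of the
tangent spaces. The component `A^μ_ν` in a basis `b` is the `μ`-th coordinate of `A b_ν`. -/
def SmoothEndField (A : ∀ x : M, TangentSpace (𝓡 n) x →L[ℝ] TangentSpace (𝓡 n) x) : Prop :=
  ContMDiff (𝓡 n) ((𝓡 n).prod 𝓘(ℝ, Euc n →L[ℝ] Euc n)) ∞
    (fun x ↦ TotalSpace.mk' (Euc n →L[ℝ] Euc n)
      (E := fun x : M ↦ TangentSpace (𝓡 n) x →L[ℝ] TangentSpace (𝓡 n) x) x (A x))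

/-- A contravariant 2-tensor `K^{μν}` at a point `x`, as the linear map from the cotangent space to
the tangent space `p ↦ K^{μν} p_ν`; thus `K^{μν} = b^μ (K b^ν)` for a basis `b` of the tangent space
and the dual basis of the cotangent space. -/
abbrev BiContra (x : M) : Type :=
  (TangentSpace (𝓡 n) x →L[ℝ] ℝ) →L[ℝ] TangentSpace (𝓡 n) x

/-- `K` is a smooth field of contravariant 2-tensors on `M`. -/
def SmoothBiContraField (K : ∀ x : M, BiContra (n := n) x) : Prop :=
  ContMDiff (𝓡 n) ((𝓡 n).prod 𝓘(ℝ, (Euc n →L[ℝ] ℝ) →L[ℝ] Euc n)) ∞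
    (fun x ↦ TotalSpace.mk' ((Euc n →L[ℝ] ℝ) →L[ℝ] Euc n)
      (E := fun x : M ↦ (TangentSpace (𝓡 n) x →L[ℝ] ℝ) →L[ℝ] TangentSpace (𝓡 n) x) x (K x))

/-- The covector `b^i` of the basis dual to `b`. -/
def dualVec {x : M} (b : Module.Basis (Fin n) ℝ (TangentSpace (𝓡 n) x)) (i : Fin n) :
    TangentSpace (𝓡 n) x →L[ℝ] ℝ :=
  LinearMap.toContinuousLinearMap (b.coord i)

/-- The component `K^{μν}` of a contravariant 2-tensor in the basis `b`. -/
def BiContra.comp {x : M} (K : BiContra (n := n) x)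
    (b : Module.Basis (Fin n) ℝ (TangentSpace (𝓡 n) x)) (μ ν : Fin n) : ℝ :=
  dualVec b μ (K (dualVec b ν))

/-- The component `A^μ_ν` of an endomorphism of the tangent space in the basis `b`. -/
def endComp {x : M} (A : TangentSpace (𝓡 n) x →L[ℝ] TangentSpace (𝓡 n) x)
    (b : Module.Basis (Fin n) ℝ (TangentSpace (𝓡 n) x)) (μ ν : Fin n) : ℝ :=
  dualVec b μ (A (b ν))

/-- The tensor with components `A^μ_α K^{αβ} B^ν_β`. -/
def BiContra.push {x : M} (A B : TangentSpace (𝓡 n) x →L[ℝ] TangentSpace (𝓡 n) x)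
    (K : BiContra (n := n) x) : BiContra (n := n) x :=
  A ∘L K ∘L (ContinuousLinearMap.precomp ℝ B)

end Tensors

/-! ### The Levi-Civita connection -/

section Connection

variable {n : ℕ} {M : Type*} [TopologicalSpace M] [ChartedSpace (Euc n) M] [IsManifold (𝓡 n) ∞ M]

/-- `cov` is the Levi-Civita connection of the Riemannian metric: the (unique) smooth
connection on the tangent bundle that is torsion free and compatible with the metric.
`cov Y x v` is the covariant derivative `∇_v Y` at `x`. -/
structure IsLeviCivita [RiemannianBundle (fun x : M ↦ TangentSpace (𝓡 n) x)]
    [IsContMDiffRiemannianBundle (𝓡 n) ∞ (Euc n) (fun x : M ↦ TangentSpace (𝓡 n) x)]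
    (cov : CovariantDerivative (𝓡 n) (Euc n) (fun x : M ↦ TangentSpace (𝓡 n) x)) : Prop where
  smooth : cov.ContMDiffCovariantDerivative ∞
  torsion_free : cov.torsion = 0
  metric :
    haveI : IsContMDiffRiemannianBundle (𝓡 n) 1 (Euc n) (fun x : M ↦ TangentSpace (𝓡 n) x) :=
      IsContMDiffRiemannianBundle.of_le (n := ∞) (by exact_mod_cast le_top)
    cov.IsMetricCompatible

variable (cov : CovariantDerivative (𝓡 n) (Euc n) (fun x : M ↦ TangentSpace (𝓡 n) x))

/-- The covariant derivative of a `(1,1)`-tensor field: `(∇_v A) w = ∇_v (A W) - A (∇_v W)`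
for a local extension `W` of the tangent vector `w` to a vector field; the value does not depend on
the extension. -/
def nablaEnd (A : ∀ x : M, TangentSpace (𝓡 n) x →L[ℝ] TangentSpace (𝓡 n) x) (x : M)
    (v w : TangentSpace (𝓡 n) x) : TangentSpace (𝓡 n) x :=
  cov (fun y ↦ A y (FiberBundle.extend (Euc n) w y)) x v
    - A x (cov (FiberBundle.extend (Euc n) w) x v)

/-- The component `∇_β A_ρ^χ` of the covariant derivative of a `(1,1)`-tensor field at `x`, in the
basis `b` of the tangent space. -/
def nablaComp (A : ∀ x : M, TangentSpace (𝓡 n) x →L[ℝ] TangentSpace (𝓡 n) x) {x : M}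
    (b : Module.Basis (Fin n) ℝ (TangentSpace (𝓡 n) x)) (β ρ χ : Fin n) : ℝ :=
  dualVec b χ (nablaEnd cov A x (b β) (b ρ))

end Connection

/-! ### The orthonormal frame bundle and horizontal vector fields -/

section Frames

variable {n : ℕ} {M : Type*} [TopologicalSpace M] [ChartedSpace (Euc n) M] [IsManifold (𝓡 n) ∞ M]

variable (n M) in
/-- The total space of the smooth vector bundle `Hom(ℝⁿ, TM)`: pairs of a point `x` of `M` and a
linear map `u : ℝⁿ → T_x M`. It contains the linear frames as an open subset and the orthonormal
frame bundle as an embedded submanifold. -/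
abbrev FrameSpace : Type _ :=
  TotalSpace (Euc n →L[ℝ] Euc n) (fun x : M ↦ Euc n →L[ℝ] TangentSpace (𝓡 n) x)

/-- The model with corners of `FrameSpace n M`. -/
abbrev frameModel (n : ℕ) :
    ModelWithCorners ℝ (Euc n × (Euc n →L[ℝ] Euc n)) (ModelProd (Euc n) (Euc n →L[ℝ] Euc n)) :=
  (𝓡 n).prod 𝓘(ℝ, Euc n →L[ℝ] Euc n)

variable (n M) in
/-- The orthonormal frame bundle `F_O(M)`: the linear isometries `u : ℝⁿ → T_x M`. -/
def orthonormalFrames [RiemannianBundle (fun x : M ↦ TangentSpace (𝓡 n) x)] :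
    Set (FrameSpace n M) :=
  {u | ∀ v w : Euc n, inner ℝ (u.2 v) (u.2 w) = inner ℝ v w}

/-- The vertical tangent vector at `u` given by `A : ℝⁿ → T_x M`: the velocity at `t = 0` of the
curve `t ↦ u + t A` in the fibre over `x`. -/
def verticalLift (u : FrameSpace n M) (A : Euc n →L[ℝ] TangentSpace (𝓡 n) u.proj) :
    TangentSpace (frameModel n) u :=
  mfderiv 𝓘(ℝ, ℝ) (frameModel n) (fun t : ℝ ↦ (⟨u.proj, u.2 + t • A⟩ : FrameSpace n M)) 0 (1 : ℝ)

variable (cov : CovariantDerivative (𝓡 n) (Euc n) (fun x : M ↦ TangentSpace (𝓡 n) x))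

/-- The covariant derivative `∇_w s` of a field `s` of linear maps `ℝⁿ → T_y M`, i.e. of the
`n`-tuple of vector fields `s e_i`. -/
def nablaFrame (s : ∀ y : M, Euc n →L[ℝ] TangentSpace (𝓡 n) y) (x : M)
    (w : TangentSpace (𝓡 n) x) : Euc n →L[ℝ] TangentSpace (𝓡 n) x :=
  ∑ i, (EuclideanSpace.proj i : Euc n →L[ℝ] ℝ).smulRight (cov (fun y ↦ s y (stdVec i)) x w)

/-- The horizontal lift of `w ∈ T_x M` to the frame `u` over `x`. If `s` is a local section through
`u`, it is `ds(w)` minus the vertical vector `∇_w s`; this does not depend on `s`, and it equals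
`ds(w)` when `s` is parallel in the direction `w`. If `u` is an orthonormal frame (and the
connection is metric), it is tangent to the orthonormal frame bundle. -/
def horizontalLift (u : FrameSpace n M) (w : TangentSpace (𝓡 n) u.proj) :
    TangentSpace (frameModel n) u :=
  letI s : ∀ y : M, Euc n →L[ℝ] TangentSpace (𝓡 n) y :=
    FiberBundle.extend (Euc n →L[ℝ] Euc n)
      (E := fun x : M ↦ Euc n →L[ℝ] TangentSpace (𝓡 n) x) u.2
  letI ds : TangentSpace (frameModel n) u :=
    mfderiv (𝓡 n) (frameModel n) (fun y : M ↦ (⟨y, s y⟩ : FrameSpace n M)) u.proj w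
  ds - verticalLift u (nablaFrame cov s u.proj w)

/-- The canonical horizontal vector field `H_v(u) = (u v)^h`. -/
def horizontalField (v : Euc n) (u : FrameSpace n M) : TangentSpace (frameModel n) u :=
  horizontalLift cov u (u.2 v)

/-- The derivative `H_i(u)[f]` of a function of the frame along `H_i = H_{e_i}`. For orthonormal
`u` it depends only on the restriction of `f` to the orthonormal frame bundle. -/
def horizontalDeriv (i : Fin n) (f : FrameSpace n M → ℝ) (u : FrameSpace n M) : ℝ :=
  mfderiv (frameModel n) 𝓘(ℝ, ℝ) f u (horizontalField cov (stdVec i) u)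

/-- The matrix-valued function `A(u) = u⁻¹ A(x) u` of the frame `u` over `x` that a
`(1,1)`-tensor field `A` on `M` defines. -/
def frameMatrix (A : ∀ x : M, TangentSpace (𝓡 n) x →L[ℝ] TangentSpace (𝓡 n) x)
    (u : FrameSpace n M) : Matrix (Fin n) (Fin n) ℝ :=
  Matrix.of fun i j ↦ (u.2.inverse (A u.proj (u.2 (stdVec j)))) i

end Frames

/-! ### The noise-induced drift on the frame bundle -/

section Drift

variable {n k : ℕ} {M : Type*} [TopologicalSpace M] [ChartedSpace (Euc n) M]
  [IsManifold (𝓡 n) ∞ M]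

/-- `Σ^{νμ}(u) = ∑_δ σ^ν_δ(u) σ^μ_δ(u)`. -/
def frameSigma (σ : FrameSpace n M → Matrix (Fin n) (Fin k) ℝ) (u : FrameSpace n M)
    (ν μ : Fin n) : ℝ :=
  ∑ δ, σ u ν δ * σ u μ δ

/-- `G^{νμ}_{ηξ}(u) = ∫_0^∞ (e^{-yγ(u)})^ν_η (e^{-yγ(u)})^μ_ξ dy`. -/
def frameG (γ : FrameSpace n M → Matrix (Fin n) (Fin n) ℝ) (u : FrameSpace n M)
    (ν μ η ξ : Fin n) : ℝ :=
  ∫ y in Set.Ioi (0 : ℝ), NormedSpace.exp (-y • γ u) ν η * NormedSpace.exp (-y • γ u) μ ξ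

/-- `J^{βα}(u) = G^{βα}_{μν}(u) Σ^{μν}(u)`. -/
def frameJ (γ : FrameSpace n M → Matrix (Fin n) (Fin n) ℝ)
    (σ : FrameSpace n M → Matrix (Fin n) (Fin k) ℝ) (u : FrameSpace n M) (β α : Fin n) : ℝ :=
  ∑ μ, ∑ ν, frameG γ u β α μ ν * frameSigma σ u μ ν

variable (cov : CovariantDerivative (𝓡 n) (Euc n) (fun x : M ↦ TangentSpace (𝓡 n) x))

/-- The noise-induced drift
`S^h(u) = -½ ∑_α (γ⁻¹)^η_μ σ^μ_α (γ⁻¹)^ξ_ν H_η[σ^ν_α] H_ξ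
  - ½ ((γ⁻¹)^η_μ J^{μχ} γ^ν_χ - J^{ην}) H_η[(γ⁻¹)^ξ_ν] H_ξ`,
all functions being evaluated at `u`. -/
def noiseInducedDrift (γ : FrameSpace n M → Matrix (Fin n) (Fin n) ℝ)
    (σ : FrameSpace n M → Matrix (Fin n) (Fin k) ℝ) (u : FrameSpace n M) :
    TangentSpace (frameModel n) u :=
  -((1 / 2 : ℝ) • ∑ α, ∑ η, ∑ μ, ∑ ξ, ∑ ν,
      ((γ u)⁻¹ η μ * σ u μ α * (γ u)⁻¹ ξ ν * horizontalDeriv cov η (fun u' ↦ σ u' ν α) u) •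
        horizontalField cov (stdVec ξ) u)
  - (1 / 2 : ℝ) • ∑ η, ∑ ν, ∑ ξ,
      (((∑ μ, ∑ χ, (γ u)⁻¹ η μ * frameJ γ σ u μ χ * γ u ν χ) - frameJ γ σ u η ν) *
          horizontalDeriv cov η (fun u' ↦ (γ u')⁻¹ ξ ν) u) •
        horizontalField cov (stdVec ξ) u

end Drift

/-! ### The tensor fields `Σ`, `J`, `L` and the vector field `Y` on the manifold -/

section Base

variable {n : ℕ} {M : Type*} [TopologicalSpace M] [ChartedSpace (Euc n) M] [IsManifold (𝓡 n) ∞ M]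
  [RiemannianBundle (fun x : M ↦ TangentSpace (𝓡 n) x)]

/-- The inverse metric `g^{αβ}`, i.e. `∑_i e_i ⊗ e_i` for an orthonormal basis `e_i`. -/
def inverseMetric (x : M) : BiContra (n := n) x :=
  ∑ i, (ContinuousLinearMap.apply ℝ ℝ (stdOrthonormalBasis ℝ (TangentSpace (𝓡 n) x) i)).smulRight
    (stdOrthonormalBasis ℝ (TangentSpace (𝓡 n) x) i)

/-- The inverse metric raises the index: it maps the covector `⟪v, ·⟫` to `v`. -/
theorem inverseMetric_innerSL (x : M) (v : TangentSpace (𝓡 n) x) :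
    inverseMetric x (innerSL ℝ v) = v := by
  have h := (stdOrthonormalBasis ℝ (TangentSpace (𝓡 n) x)).sum_repr' v
  simpa [inverseMetric, real_inner_comm] using h

/-- The integral over `(0, ∞)` of a family of contravariant 2-tensors at `x`, taken component by
component in an orthonormal basis `e_i`:
`∑_{ij} (∫_0^∞ K^{ij}(y) dy) e_i ⊗ e_j`. -/
def integralTensor {x : M} (K : ℝ → BiContra (n := n) x) : BiContra (n := n) x :=
  letI e := stdOrthonormalBasis ℝ (TangentSpace (𝓡 n) x)
  ∑ i, ∑ j, (∫ y in Set.Ioi (0 : ℝ), inner ℝ (e i) (K y (innerSL ℝ (e j)))) •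
    (ContinuousLinearMap.apply ℝ ℝ (e j)).smulRight (e i)

variable (γ σ : ∀ x : M, TangentSpace (𝓡 n) x →L[ℝ] TangentSpace (𝓡 n) x)

/-- `Σ^{ξη} = σ^ξ_α g^{αβ} σ^η_β`. -/
def tensorSigma (x : M) : BiContra (n := n) x :=
  BiContra.push (σ x) (σ x) (inverseMetric x)

/-- The integrand `(e^{-yγ})^μ_δ Σ^{δη} (e^{-yγ})^ν_η` of `J^{μν}`. -/
def integrandJ (x : M) (y : ℝ) : BiContra (n := n) x :=
  BiContra.push (NormedSpace.exp (-y • γ x)) (NormedSpace.exp (-y • γ x)) (tensorSigma σ x)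

/-- `J^{μν} = ∫_0^∞ (e^{-yγ})^μ_δ Σ^{δη} (e^{-yγ})^ν_η dy`. -/
def tensorJ (x : M) : BiContra (n := n) x :=
  integralTensor (integrandJ γ σ x)

/-- The pointwise inverse `γ⁻¹` of a field of (invertible) endomorphisms. -/
def inverseField (x : M) : TangentSpace (𝓡 n) x →L[ℝ] TangentSpace (𝓡 n) x :=
  (γ x).inverse

/-- The integrand `(γ⁻¹ e^{-yγ})^μ_α Σ^{αβ} (γ e^{-yγ})^ν_β` of `L^{μν}`. -/
def integrandL (x : M) (y : ℝ) : BiContra (n := n) x :=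
  BiContra.push (inverseField γ x ∘L NormedSpace.exp (-y • γ x))
    (γ x ∘L NormedSpace.exp (-y • γ x)) (tensorSigma σ x)

/-- `L^{μν} = ∫_0^∞ (γ⁻¹ e^{-yγ})^μ_α Σ^{αβ} (γ e^{-yγ})^ν_β dy`. -/
def tensorL (x : M) : BiContra (n := n) x :=
  integralTensor (integrandL γ σ x)

variable (cov : CovariantDerivative (𝓡 n) (Euc n) (fun x : M ↦ TangentSpace (𝓡 n) x))

/-- The vector `Y(x) = Y^χ b_χ`, where, with all components taken in the basis `b` of `T_x M`,
`Y^χ = -½ g^{νρ} (γ⁻¹σ)^β_ν (γ⁻¹)_δ^χ ∇_β σ_ρ^δ - ½ (L^{βρ} - J^{βρ}) ∇_β (γ⁻¹)_ρ^χ`. -/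
def driftVector (x : M) (b : Module.Basis (Fin n) ℝ (TangentSpace (𝓡 n) x)) :
    TangentSpace (𝓡 n) x :=
  ∑ χ, (-(1 / 2) * (∑ ν, ∑ ρ, ∑ β, ∑ δ,
            (inverseMetric x).comp b ν ρ * endComp (inverseField γ x ∘L σ x) b β ν
              * endComp (inverseField γ x) b χ δ * nablaComp cov σ b β ρ δ)
        - (1 / 2) * (∑ β, ∑ ρ,
            ((tensorL γ σ x).comp b β ρ - (tensorJ γ σ x).comp b β ρ)
              * nablaComp cov (inverseField γ) b β ρ χ)) • b χ

/-- The symmetric part `½ (γ + γᵀ)` of `γ` at `x`, the transpose being taken with respect to the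
metric. -/
def symmetricPart (x : M) : Module.End ℝ (TangentSpace (𝓡 n) x) :=
  (1 / 2 : ℝ) • ((γ x : TangentSpace (𝓡 n) x →ₗ[ℝ] TangentSpace (𝓡 n) x)
    + LinearMap.adjoint (γ x : TangentSpace (𝓡 n) x →ₗ[ℝ] TangentSpace (𝓡 n) x))

end Base

end NoiseDrift

end

/-! For an orthonormal frame `u` over `x`, the formula for `S^h(u)` is the component formula for
`Y(x)` in the basis `u e_i`, with each basis vector replaced by its horizontal lift; the lift is
linear, so it suffices to match coefficients. The matrix of a tensor field in the frame consists of
its components in that basis. Since `g` has components `δ` there, the frame versions of `Σ` and `J`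
are the components of the tensors (`frameSigma_eq`, `frameJ_eq`). The factors `γ⁻¹` and `γ` do not
depend on `y` and come out of the integral for `L`, so `L = γ⁻¹ J γᵀ` (`tensorL_eq_push`) and the
bracket in `S^h` is `L - J`.

The differential input is `horizontalDeriv_frameMatrix`: `H_k` of a component of `A` in the frame is
the same component of `∇_k A`. Differentiate the relation `A s_j = A^i_j(s) s_i` covariantly along a
local section `s` through `u`, and differentiate its analogue in the fibre along the vertical vector
`∇s`. Subtracting the two, the terms with `∇ s_i` cancel and the horizontal derivative of `A^i_j`
remains.

The eigenvalue bound makes `e^{-yγ}` decay exponentially. This gives absolute convergence and the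
invertibility of `γ`. Smoothness of `J` needs no differentiation under the integral: `J` solves the
Lyapunov equation `γ J + J γᵀ = Σ`, and the same integral solves it for every right-hand side. The
Lyapunov operator is therefore onto, hence invertible in finite dimension, and its inverse depends
smoothly on `γ`. Finally, `Y` is a contraction of tensors, so it is independent of the basis
(`sum_comp_smul_eq`), and its smoothness is read off in a smooth local frame. -/

set_option linter.unusedSectionVars false

noncomputable section

namespace NoiseDrift

/-! ### Exponentially stable endomorphisms and the Lyapunov equation -/

section Lyapunov

variable {E : Type*} [NormedAddCommGroup E] [InnerProductSpace ℝ E]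

/-- The exponential `exp (-t A)` decays exponentially as `t → ∞`. -/
def ExpDecay (A : E →L[ℝ] E) : Prop :=
  ∃ c : ℝ, 0 < c ∧ ∀ t : ℝ, 0 ≤ t → ‖NormedSpace.exp (-t • A)‖ ≤ Real.exp (-c * t)

variable [FiniteDimensional ℝ E]

theorem hasDerivAt_exp_neg_smul (A : E →L[ℝ] E) (t : ℝ) :
    HasDerivAt (fun s : ℝ ↦ NormedSpace.exp (-s • A)) (-(A ∘L NormedSpace.exp (-t • A))) t := by
  have : CompleteSpace E := FiniteDimensional.complete ℝ E
  have h := hasDerivAt_exp_smul_const' (𝕂 := ℝ) A (-t)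
  have h2 := h.scomp t (hasDerivAt_neg t)
  simpa [Function.comp_def, ContinuousLinearMap.mul_def] using h2

theorem hasDerivAt_exp_neg_smul_apply (A : E →L[ℝ] E) (v : E) (t : ℝ) :
    HasDerivAt (fun s : ℝ ↦ NormedSpace.exp (-s • A) v) (-(A (NormedSpace.exp (-t • A) v))) t := by
  have h := (hasDerivAt_exp_neg_smul A t).clm_apply (hasDerivAt_const t v)
  simpa using h

/-- An energy estimate: along `w' = -A w` the squared norm has derivative `-2⟨A w, w⟩ ≤ -2c‖w‖²`, so
`e^{2cs}‖w(s)‖²` is nonincreasing. -/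
theorem expDecay_of_inner_le {A : E →L[ℝ] E} {c : ℝ} (hc : 0 < c)
    (h : ∀ v, c * ‖v‖ ^ 2 ≤ inner ℝ (A v) v) : ExpDecay A := by
  refine ⟨c, hc, fun t ht ↦ ContinuousLinearMap.opNorm_le_bound _ (Real.exp_pos _).le fun v ↦ ?_⟩
  let w : ℝ → E := fun s ↦ NormedSpace.exp (-s • A) v
  have hw (s : ℝ) : HasDerivAt w (-(A (w s))) s := hasDerivAt_exp_neg_smul_apply A v s
  let f : ℝ → ℝ := fun s ↦ Real.exp (2 * c * s) * ‖w s‖ ^ 2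
  have hf (s : ℝ) : HasDerivAt f (Real.exp (2 * c * s) * (2 * c) * ‖w s‖ ^ 2
      + Real.exp (2 * c * s) * (2 * inner ℝ (w s) (-(A (w s))))) s := by
    refine HasDerivAt.mul ?_ ((hw s).norm_sq)
    simpa using ((hasDerivAt_id s).const_mul (2 * c)).exp
  have hanti : Antitone f := by
    refine antitone_of_hasDerivAt_nonpos hf fun s ↦ ?_
    have h1 := h (w s)
    change _ ≤ (0 : ℝ)
    rw [inner_neg_right, real_inner_comm]
    have := mul_nonneg (Real.exp_pos (2 * c * s)).le (sub_nonneg.2 h1)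
    nlinarith
  have h0 : f t ≤ f 0 := hanti ht
  have hw0 : w 0 = v := by simp [w]
  simp only [f, mul_zero, Real.exp_zero, one_mul, hw0] at h0
  -- The monotone quantity is a perfect square, so the bound survives taking square roots, with rate
  -- `c` instead of `2c`.
  have h1 : (Real.exp (c * t) * ‖w t‖) ^ 2 ≤ ‖v‖ ^ 2 := by
    rw [mul_pow, ← Real.exp_nat_mul]
    convert h0 using 3
    push_cast
    ring
  have h2 : Real.exp (c * t) * ‖w t‖ ≤ ‖v‖ :=
    (sq_le_sq₀ (by positivity) (norm_nonneg v)).1 h1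
  calc ‖w t‖ = Real.exp (-c * t) * (Real.exp (c * t) * ‖w t‖) := by
        rw [← mul_assoc, ← Real.exp_add]; simp
    _ ≤ Real.exp (-c * t) * ‖v‖ := by gcongr

/-- In an orthonormal eigenbasis the quadratic form is the sum of eigenvalues times squared
coordinates. -/
theorem inner_le_of_eigenvalues_ge {S : E →ₗ[ℝ] E} (hS : S.IsSymmetric) {c : ℝ}
    (h : ∀ μ : ℝ, Module.End.HasEigenvalue S μ → c ≤ μ) (v : E) :
    c * ‖v‖ ^ 2 ≤ inner ℝ (S v) v := by
  let b := hS.eigenvectorBasis rfl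
  rw [← b.sum_inner_mul_inner (S v) v, ← b.sum_sq_norm_inner_right v, Finset.mul_sum]
  refine Finset.sum_le_sum fun i _ ↦ ?_
  have h1 : inner ℝ (S v) (b i) = hS.eigenvalues rfl i * inner ℝ (b i) v := by
    rw [hS v (b i), hS.apply_eigenvectorBasis rfl i]
    simp only [RCLike.ofReal_real_eq_id, id_eq]
    rw [inner_smul_right, real_inner_comm]
  rw [h1, Real.norm_eq_abs, sq_abs, mul_assoc, ← sq]
  exact mul_le_mul_of_nonneg_right (h _ (hS.hasEigenvalue_eigenvalues rfl i)) (sq_nonneg _)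

/-- If the eigenvalues of the symmetric part of `A` are bounded below by a positive constant,
then `exp (-t A)` decays exponentially. -/
theorem expDecay_of_eigenvalues_ge {A : E →L[ℝ] E} {c : ℝ} (hc : 0 < c)
    (h : ∀ μ : ℝ, Module.End.HasEigenvalue
      ((1 / 2 : ℝ) • ((A : E →ₗ[ℝ] E) + LinearMap.adjoint (A : E →ₗ[ℝ] E))) μ → c ≤ μ) :
    ExpDecay A := by
  refine expDecay_of_inner_le hc fun v ↦ ?_
  have hS : ((1 / 2 : ℝ) •
      ((A : E →ₗ[ℝ] E) + LinearMap.adjoint (A : E →ₗ[ℝ] E))).IsSymmetric := by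
    intro x y
    simp [inner_smul_left, inner_smul_right, inner_add_left, inner_add_right,
      LinearMap.adjoint_inner_left, LinearMap.adjoint_inner_right, add_comm]
  have h1 := inner_le_of_eigenvalues_ge hS h v
  -- The antisymmetric part of `A` does not contribute to the quadratic form.
  have h2 : inner ℝ (((1 / 2 : ℝ) •
      ((A : E →ₗ[ℝ] E) + LinearMap.adjoint (A : E →ₗ[ℝ] E))) v) v = inner ℝ (A v) v := by
    rw [LinearMap.smul_apply, LinearMap.add_apply, real_inner_smul_left, inner_add_left,
      LinearMap.adjoint_inner_left, real_inner_comm, ContinuousLinearMap.coe_coe]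
    rw [real_inner_comm]
    ring
  rwa [h2] at h1

theorem ExpDecay.tendsto_zero {A : E →L[ℝ] E} (hA : ExpDecay A) :
    Filter.Tendsto (fun t : ℝ ↦ NormedSpace.exp (-t • A)) Filter.atTop (nhds 0) := by
  obtain ⟨c, hc, h⟩ := hA
  have h1 : Filter.Tendsto (fun t : ℝ ↦ Real.exp (-c * t)) Filter.atTop (nhds 0) := by
    refine Real.tendsto_exp_atBot.comp ?_
    exact Filter.tendsto_id.const_mul_atTop_of_neg (neg_neg_of_pos hc)
  exact squeeze_zero_norm' (Filter.eventually_atTop.2 ⟨0, h⟩) h1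

/-- A vector in the kernel is fixed by every `exp (-t A)`, yet decay sends it to zero. -/
theorem ExpDecay.injective {A : E →L[ℝ] E} (hA : ExpDecay A) : Function.Injective A := by
  refine (injective_iff_map_eq_zero A).2 fun v hv ↦ ?_
  have hcom (t : ℝ) : A (NormedSpace.exp (-t • A) v) = NormedSpace.exp (-t • A) (A v) := by
    have : Commute A (NormedSpace.exp (-t • A)) :=
      ((Commute.refl A).smul_right (-t)).exp_right
    exact congrArg (fun B : E →L[ℝ] E ↦ B v) this
  have hconst (t : ℝ) : NormedSpace.exp (-t • A) v = v := by
    have h := is_const_of_deriv_eq_zero (f := fun s : ℝ ↦ NormedSpace.exp (-s • A) v)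
      (fun s ↦ (hasDerivAt_exp_neg_smul_apply A v s).differentiableAt)
      (fun s ↦ by rw [(hasDerivAt_exp_neg_smul_apply A v s).deriv, hcom, hv]; simp) t 0
    simpa using h
  have hlim := ((ContinuousLinearMap.apply ℝ E v).continuous.tendsto 0).comp hA.tendsto_zero
  simp only [Function.comp_def, ContinuousLinearMap.apply_apply, hconst, map_zero] at hlim
  exact tendsto_nhds_unique tendsto_const_nhds hlim

theorem ExpDecay.isInvertible {A : E →L[ℝ] E} (hA : ExpDecay A) : A.IsInvertible :=
  ⟨(LinearEquiv.ofInjectiveEndo (A : E →ₗ[ℝ] E) hA.injective).toContinuousLinearEquiv, by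
    ext v; rfl⟩

/-- The integrand `p_μ (e^{-tA})^μ_δ K^{δη} (e^{-tA})^ν_η q_ν`. -/
def expPairing (A : E →L[ℝ] E) (K : (E →L[ℝ] ℝ) →L[ℝ] E) (p q : E →L[ℝ] ℝ) (t : ℝ) : ℝ :=
  p (NormedSpace.exp (-t • A) (K (q ∘L NormedSpace.exp (-t • A))))

/-- Each of the two exponentials contributes a factor `-A`, which is absorbed into the adjacent
covector. The derivative is thus again made of pairings of the same kind. -/
theorem hasDerivAt_expPairing (A : E →L[ℝ] E) (K : (E →L[ℝ] ℝ) →L[ℝ] E) (p q : E →L[ℝ] ℝ)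
    (t : ℝ) : HasDerivAt (expPairing A K p q)
      (-(expPairing A K (p ∘L A) q t + expPairing A K p (q ∘L A) t)) t := by
  have h1 := hasDerivAt_exp_neg_smul A t
  have h2 := (hasDerivAt_const t q).clm_comp h1
  have h3 := (hasDerivAt_const t K).clm_apply h2
  have h4 := (hasDerivAt_const t p).clm_apply (h1.clm_apply h3)
  convert! h4 using 1
  simp [expPairing, ContinuousLinearMap.comp_assoc]
  ring

theorem ExpDecay.norm_expPairing_le {A : E →L[ℝ] E} (hA : ExpDecay A)
    (K : (E →L[ℝ] ℝ) →L[ℝ] E) (p q : E →L[ℝ] ℝ) :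
    ∃ C c : ℝ, 0 < c ∧ ∀ t, 0 ≤ t → ‖expPairing A K p q t‖ ≤ C * Real.exp (-c * t) := by
  obtain ⟨c, hc, h⟩ := hA
  refine ⟨‖p‖ * ‖K‖ * ‖q‖, 2 * c, by positivity, fun t ht ↦ ?_⟩
  set e : E →L[ℝ] E := NormedSpace.exp (-t • A) with he
  have h1 : ‖e‖ ≤ Real.exp (-c * t) := h t ht
  calc ‖expPairing A K p q t‖ ≤ ‖p‖ * (‖e‖ * (‖K‖ * (‖q‖ * ‖e‖))) := by
        refine (p.le_opNorm _).trans ?_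
        gcongr
        refine (e.le_opNorm _).trans ?_
        gcongr
        refine (K.le_opNorm _).trans ?_
        gcongr
        exact q.opNorm_comp_le e
    _ ≤ ‖p‖ * (Real.exp (-c * t) * (‖K‖ * (‖q‖ * Real.exp (-c * t)))) := by gcongr
    _ = ‖p‖ * ‖K‖ * ‖q‖ * (Real.exp (-c * t) * Real.exp (-c * t)) := by ring
    _ = ‖p‖ * ‖K‖ * ‖q‖ * Real.exp (-(2 * c) * t) := by rw [← Real.exp_add]; ring_nf

theorem continuous_expPairing (A : E →L[ℝ] E) (K : (E →L[ℝ] ℝ) →L[ℝ] E) (p q : E →L[ℝ] ℝ) :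
    Continuous (expPairing A K p q) :=
  continuous_iff_continuousAt.2 fun t ↦ (hasDerivAt_expPairing A K p q t).continuousAt

theorem ExpDecay.integrableOn_expPairing {A : E →L[ℝ] E} (hA : ExpDecay A)
    (K : (E →L[ℝ] ℝ) →L[ℝ] E) (p q : E →L[ℝ] ℝ) :
    IntegrableOn (expPairing A K p q) (Set.Ioi 0) := by
  obtain ⟨C, c, hc, h⟩ := hA.norm_expPairing_le K p q
  refine Integrable.mono' ((exp_neg_integrableOn_Ioi 0 hc).const_mul C)
    (continuous_expPairing A K p q).aestronglyMeasurable ?_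
  exact (ae_restrict_iff' measurableSet_Ioi).2 (.of_forall fun t ht ↦ h t (le_of_lt ht))

theorem ExpDecay.tendsto_expPairing {A : E →L[ℝ] E} (hA : ExpDecay A)
    (K : (E →L[ℝ] ℝ) →L[ℝ] E) (p q : E →L[ℝ] ℝ) :
    Filter.Tendsto (expPairing A K p q) Filter.atTop (nhds 0) := by
  obtain ⟨C, c, hc, h⟩ := hA.norm_expPairing_le K p q
  have h1 : Filter.Tendsto (fun t : ℝ ↦ C * Real.exp (-c * t)) Filter.atTop (nhds (C * 0)) :=
    (Real.tendsto_exp_atBot.comp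
      (Filter.tendsto_id.const_mul_atTop_of_neg (neg_neg_of_pos hc))).const_mul C
  rw [mul_zero] at h1
  exact squeeze_zero_norm' (Filter.eventually_atTop.2 ⟨0, h⟩) h1

/-- The Lyapunov equation for `∫ e^{-tA} K e^{-tAᵀ} dt`, tested against covectors. -/
theorem ExpDecay.integral_expPairing_add {A : E →L[ℝ] E} (hA : ExpDecay A)
    (K : (E →L[ℝ] ℝ) →L[ℝ] E) (p q : E →L[ℝ] ℝ) :
    (∫ t in Set.Ioi (0 : ℝ), expPairing A K (p ∘L A) q t)
      + (∫ t in Set.Ioi (0 : ℝ), expPairing A K p (q ∘L A) t) = p (K q) := by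
  have h1 := hA.integrableOn_expPairing K (p ∘L A) q
  have h2 := hA.integrableOn_expPairing K p (q ∘L A)
  -- The fundamental theorem of calculus on the half-line: the pairing vanishes at infinity and
  -- equals `p (K q)` at `0`.
  have h := integral_Ioi_of_hasDerivAt_of_tendsto
    (continuous_expPairing A K p q).continuousWithinAt
    (fun t _ ↦ hasDerivAt_expPairing A K p q t) (h1.add h2).neg (hA.tendsto_expPairing K p q)
  rw [integral_neg, integral_add h1 h2] at h
  have h0 : expPairing A K p q 0 = p (K q) := by
    simp only [expPairing, neg_zero, zero_smul, NormedSpace.exp_zero]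
    rfl
  rw [h0] at h
  linarith

end Lyapunov

/-! ### The Lyapunov operator as a smooth function of its coefficient. -/

theorem isInvertible_of_surjective {V : Type*} [NormedAddCommGroup V] [NormedSpace ℝ V]
    [FiniteDimensional ℝ V] {A : V →L[ℝ] V} (hA : Function.Surjective A) : A.IsInvertible :=
  ⟨(LinearEquiv.ofBijective (A : V →ₗ[ℝ] V)
    ⟨LinearMap.injective_iff_surjective.2 hA, hA⟩).toContinuousLinearEquiv, by ext; rfl⟩

/-- The Lyapunov operator `X ↦ A X + X Aᵀ` on contravariant 2-tensors. -/
def lyapunov {F : Type*} [NormedAddCommGroup F] [NormedSpace ℝ F] (A : F →L[ℝ] F) :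
    ((F →L[ℝ] ℝ) →L[ℝ] F) →L[ℝ] ((F →L[ℝ] ℝ) →L[ℝ] F) :=
  ContinuousLinearMap.compL ℝ (F →L[ℝ] ℝ) F F A
    + (ContinuousLinearMap.compL ℝ (F →L[ℝ] ℝ) (F →L[ℝ] ℝ) F).flip
        ((ContinuousLinearMap.compL ℝ F F ℝ).flip A)

theorem lyapunov_apply {F : Type*} [NormedAddCommGroup F] [NormedSpace ℝ F] (A : F →L[ℝ] F)
    (X : (F →L[ℝ] ℝ) →L[ℝ] F) (q : F →L[ℝ] ℝ) :
    lyapunov A X q = A (X q) + X (q ∘L A) := rfl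

set_option maxSynthPendingDepth 3 in
theorem isInvertible_lyapunov_of_surjective {F : Type*} [NormedAddCommGroup F] [NormedSpace ℝ F]
    [FiniteDimensional ℝ F] {A : F →L[ℝ] F} (hA : Function.Surjective (lyapunov A)) :
    (lyapunov A).IsInvertible :=
  isInvertible_of_surjective (V := (F →L[ℝ] ℝ) →L[ℝ] F) hA

set_option maxSynthPendingDepth 3 in
theorem contDiff_lyapunov {F : Type*} [NormedAddCommGroup F] [NormedSpace ℝ F] :
    ContDiff ℝ ∞ (lyapunov (F := F)) := by
  refine ContDiff.add (ContinuousLinearMap.contDiff _) ?_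
  exact (ContinuousLinearMap.contDiff _).comp
    (ContinuousLinearMap.contDiff (ContinuousLinearMap.compL ℝ F F ℝ).flip)

/-! ### Components of tensors at a point, and change of basis. -/

section Pointwise

variable {n : ℕ} {M : Type*} [TopologicalSpace M] [ChartedSpace (Euc n) M]

theorem sum_dualVec_smul {x : M} (b : Module.Basis (Fin n) ℝ (TangentSpace (𝓡 n) x))
    (v : TangentSpace (𝓡 n) x) : ∑ i, dualVec b i v • b i = v :=
  b.sum_repr v

theorem sum_apply_smul_dualVec {x : M} (b : Module.Basis (Fin n) ℝ (TangentSpace (𝓡 n) x))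
    (p : TangentSpace (𝓡 n) x →L[ℝ] ℝ) : ∑ i, p (b i) • dualVec b i = p := by
  ext v
  conv_rhs => rw [← sum_dualVec_smul b v]
  simp [mul_comm]

theorem dualVec_apply_basis {x : M} (b : Module.Basis (Fin n) ℝ (TangentSpace (𝓡 n) x))
    (i j : Fin n) : dualVec b i (b j) = if i = j then 1 else 0 := by
  change b.repr (b j) i = _
  rw [b.repr_self, Finsupp.single_apply]
  simp only [eq_comm]

theorem endComp_comp {x : M} (A B : TangentSpace (𝓡 n) x →L[ℝ] TangentSpace (𝓡 n) x)
    (b : Module.Basis (Fin n) ℝ (TangentSpace (𝓡 n) x)) (i j : Fin n) :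
    endComp (A ∘L B) b i j = ∑ k, endComp A b i k * endComp B b k j := by
  have h : A (B (b j)) = ∑ k, dualVec b k (B (b j)) • A (b k) := by
    conv_lhs => rw [← sum_dualVec_smul b (B (b j))]
    simp
  simp [endComp, h, mul_comm]

theorem comp_push {x : M} (A B : TangentSpace (𝓡 n) x →L[ℝ] TangentSpace (𝓡 n) x)
    (K : BiContra (n := n) x) (b : Module.Basis (Fin n) ℝ (TangentSpace (𝓡 n) x))
    (i j : Fin n) :
    (BiContra.push A B K).comp b i j
      = ∑ k, ∑ l, endComp A b i k * K.comp b k l * endComp B b j l := by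
  have h : dualVec b j ∘L B = ∑ l, endComp B b j l • dualVec b l :=
    (sum_apply_smul_dualVec b (dualVec b j ∘L B)).symm
  have h2 (v : TangentSpace (𝓡 n) x) : dualVec b i (A v) = ∑ k, endComp A b i k * dualVec b k v := by
    conv_lhs => rw [← sum_dualVec_smul b v]
    simp [endComp, mul_comm]
  change dualVec b i (A (K (dualVec b j ∘L B))) = _
  rw [h, h2]
  refine Finset.sum_congr rfl fun k _ ↦ ?_
  simp only [map_sum, map_smul, Finset.mul_sum, smul_eq_mul]
  exact Finset.sum_congr rfl fun l _ ↦ by simp only [BiContra.comp]; ring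

/-- The contraction of a contravariant 2-tensor with a bilinear map does not depend on the basis
in which it is computed. -/
theorem sum_comp_smul_eq {x : M} {F : Type*} [AddCommGroup F] [Module ℝ F]
    (b c : Module.Basis (Fin n) ℝ (TangentSpace (𝓡 n) x)) (K : BiContra (n := n) x)
    (B : TangentSpace (𝓡 n) x →ₗ[ℝ] TangentSpace (𝓡 n) x →ₗ[ℝ] F) :
    ∑ i, ∑ j, K.comp b i j • B (b i) (b j) = ∑ i, ∑ j, K.comp c i j • B (c i) (c j) := by
  -- Summing over the first index removes one use of the basis; the remaining sum pairs a basis with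
  -- its dual.
  have key (a : Module.Basis (Fin n) ℝ (TangentSpace (𝓡 n) x)) :
      ∑ i, ∑ j, K.comp a i j • B (a i) (a j) = ∑ j, B (K (dualVec a j)) (a j) := by
    rw [Finset.sum_comm]
    refine Finset.sum_congr rfl fun j _ ↦ ?_
    conv_rhs => rw [← sum_dualVec_smul a (K (dualVec a j))]
    simp [BiContra.comp]
  rw [key, key]
  have h1 (j : Fin n) : B (K (dualVec b j)) (b j)
      = ∑ i, dualVec c i (b j) • B (K (dualVec b j)) (c i) := by
    conv_lhs => rw [← sum_dualVec_smul c (b j)]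
    simp
  have h2 (i : Fin n) : B (K (dualVec c i)) (c i)
      = ∑ j, dualVec c i (b j) • B (K (dualVec b j)) (c i) := by
    conv_lhs => rw [← sum_apply_smul_dualVec b (dualVec c i)]
    simp
  simp only [h1, h2]
  exact Finset.sum_comm

end Pointwise

/-! ### The tensors `J` and `L` at a point. -/

section Riemannian

variable {n : ℕ} {M : Type*} [TopologicalSpace M] [ChartedSpace (Euc n) M]
  [RiemannianBundle (fun x : M ↦ TangentSpace (𝓡 n) x)]

/-- The definition fixes an orthonormal basis; expanding `p` and `q` in it and integrating the
finite sum term by term shows that the choice is immaterial. All later uses of the integral go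
through this formula. -/
theorem integralTensor_apply {x : M} (K : ℝ → BiContra (n := n) x)
    (hK : ∀ p q : TangentSpace (𝓡 n) x →L[ℝ] ℝ, IntegrableOn (fun y ↦ p (K y q)) (Set.Ioi 0))
    (p q : TangentSpace (𝓡 n) x →L[ℝ] ℝ) :
    p (integralTensor K q) = ∫ y in Set.Ioi (0 : ℝ), p (K y q) := by
  let e := stdOrthonormalBasis ℝ (TangentSpace (𝓡 n) x)
  have hv (v : TangentSpace (𝓡 n) x) : p v = ∑ i, p (e i) * inner ℝ (e i) v := by
    conv_lhs => rw [← e.sum_repr' v]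
    simp [mul_comm]
  have hq : q = ∑ j, q (e j) • innerSL ℝ (e j) := by
    ext v
    conv_lhs => rw [← e.sum_repr' v]
    simp [mul_comm]
  have hpq (y : ℝ) : p (K y q)
      = ∑ i, ∑ j, p (e i) * q (e j) * inner ℝ (e i) (K y (innerSL ℝ (e j))) := by
    rw [hv]
    refine Finset.sum_congr rfl fun i _ ↦ ?_
    conv_lhs => rw [hq]
    simp only [map_sum, map_smul, inner_sum, inner_smul_right, Finset.mul_sum]
    exact Finset.sum_congr rfl fun j _ ↦ by ring
  have hint (i j) : IntegrableOn (fun y ↦ inner ℝ (e i) (K y (innerSL ℝ (e j)))) (Set.Ioi 0) :=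
    hK (innerSL ℝ (e i)) (innerSL ℝ (e j))
  simp only [hpq]
  rw [integral_finsetSum _ fun i _ ↦ integrable_finsetSum _ fun j _ ↦ (hint i j).const_mul _]
  simp only [integral_finsetSum _ fun j _ ↦ (hint _ j).const_mul _, integral_const_mul]
  simp only [integralTensor, sum_apply, map_sum,
    smul_apply, ContinuousLinearMap.smulRight_apply, map_smul, smul_eq_mul,
    ContinuousLinearMap.apply_apply]
  exact Finset.sum_congr rfl fun i _ ↦ Finset.sum_congr rfl fun j _ ↦ by
    simp only [e]; ring

variable {γ σ : ∀ x : M, TangentSpace (𝓡 n) x →L[ℝ] TangentSpace (𝓡 n) x}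

theorem expDecay_of_symmetricPart {c₀ : ℝ} (hc₀ : 0 < c₀) {x : M}
    (h : ∀ c : ℝ, Module.End.HasEigenvalue (symmetricPart γ x) c → c₀ ≤ c) :
    ExpDecay (γ x) :=
  expDecay_of_eigenvalues_ge hc₀ h

theorem integrableOn_integrandJ {x : M} (hγ : ExpDecay (γ x))
    (p q : TangentSpace (𝓡 n) x →L[ℝ] ℝ) :
    IntegrableOn (fun y ↦ p (integrandJ γ σ x y q)) (Set.Ioi 0) :=
  hγ.integrableOn_expPairing (tensorSigma σ x) p q

theorem integrableOn_integrandL {x : M} (hγ : ExpDecay (γ x))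
    (p q : TangentSpace (𝓡 n) x →L[ℝ] ℝ) :
    IntegrableOn (fun y ↦ p (integrandL γ σ x y q)) (Set.Ioi 0) :=
  hγ.integrableOn_expPairing (tensorSigma σ x) (p ∘L inverseField γ x) (q ∘L γ x)

theorem tensorJ_apply {x : M} (hγ : ExpDecay (γ x)) (p q : TangentSpace (𝓡 n) x →L[ℝ] ℝ) :
    p (tensorJ γ σ x q)
      = ∫ y in Set.Ioi (0 : ℝ), expPairing (γ x) (tensorSigma σ x) p q y :=
  integralTensor_apply _ (integrableOn_integrandJ hγ) p q

theorem ext_of_forall_covector {x : M} {K L : BiContra (n := n) x}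
    (h : ∀ p q : TangentSpace (𝓡 n) x →L[ℝ] ℝ, p (K q) = p (L q)) : K = L := by
  ext1 q
  exact ext_inner_left ℝ fun v ↦ h (innerSL ℝ v) q

/-- The factors `γ⁻¹` and `γ` are constant in `y` and can be moved onto the test covectors, which
turns the integral for `L` into one for `J`. -/
theorem tensorL_eq_push {x : M} (hγ : ExpDecay (γ x)) :
    tensorL γ σ x = BiContra.push (inverseField γ x) (γ x) (tensorJ γ σ x) := by
  refine ext_of_forall_covector fun p q ↦ ?_
  refine (integralTensor_apply _ (integrableOn_integrandL hγ) p q).trans ?_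
  exact (tensorJ_apply hγ (p ∘L inverseField γ x) (q ∘L γ x)).symm

/-- `X = ∫ e^{-yA} K e^{-yAᵀ} dy` solves the Lyapunov equation `A X + X Aᵀ = K`. -/
theorem integralTensor_lyapunov {x : M} {A : TangentSpace (𝓡 n) x →L[ℝ] TangentSpace (𝓡 n) x}
    (hA : ExpDecay A) (K : BiContra (n := n) x) (q : TangentSpace (𝓡 n) x →L[ℝ] ℝ) :
    A (integralTensor (fun y ↦ BiContra.push (NormedSpace.exp (-y • A))
        (NormedSpace.exp (-y • A)) K) q)
      + integralTensor (fun y ↦ BiContra.push (NormedSpace.exp (-y • A))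
        (NormedSpace.exp (-y • A)) K) (q ∘L A) = K q := by
  have hint := hA.integrableOn_expPairing K
  refine ext_inner_left ℝ fun v ↦ ?_
  have h1 := integralTensor_apply (fun y ↦ BiContra.push (NormedSpace.exp (-y • A))
        (NormedSpace.exp (-y • A)) K) hint (innerSL ℝ v ∘L A) q
  have h2 := integralTensor_apply (fun y ↦ BiContra.push (NormedSpace.exp (-y • A))
        (NormedSpace.exp (-y • A)) K) hint (innerSL ℝ v) (q ∘L A)
  rw [inner_add_right]
  exact (congrArg₂ (· + ·) h1 h2).trans (hA.integral_expPairing_add K (innerSL ℝ v) q)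

end Riemannian

/-! ### Smooth tensor fields in local trivializations. -/

section Coordinates

variable {n : ℕ} {M : Type*} [TopologicalSpace M] [ChartedSpace (Euc n) M] [IsManifold (𝓡 n) ∞ M]

variable (n) in
/-- The trivialization of the tangent bundle around `x`. -/
abbrev tangentTriv (x : M) : Trivialization (Euc n)
    (TotalSpace.proj : TotalSpace (Euc n) (fun y : M ↦ TangentSpace (𝓡 n) y) → M) :=
  trivializationAt (Euc n) (fun y : M ↦ TangentSpace (𝓡 n) y) x

variable (n) in
/-- The map `T_y M → ℝⁿ` of the trivialization around `x`. -/
abbrev toCoord (x y : M) : TangentSpace (𝓡 n) y →L[ℝ] Euc n :=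
  (tangentTriv n x).continuousLinearMapAt ℝ y

variable (n) in
/-- The map `ℝⁿ → T_y M` of the trivialization around `x`. -/
abbrev ofCoord (x y : M) : Euc n →L[ℝ] TangentSpace (𝓡 n) y :=
  (tangentTriv n x).symmL ℝ y

theorem ofCoord_toCoord {x y : M} (hy : y ∈ (tangentTriv n x).baseSet)
    (v : TangentSpace (𝓡 n) y) : ofCoord n x y (toCoord n x y v) = v :=
  (tangentTriv n x).symmL_continuousLinearMapAt hy v

theorem toCoord_ofCoord {x y : M} (hy : y ∈ (tangentTriv n x).baseSet) (v : Euc n) :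
    toCoord n x y (ofCoord n x y v) = v :=
  (tangentTriv n x).continuousLinearMapAt_symmL hy v

theorem eventually_mem_baseSet (x : M) : ∀ᶠ y in nhds x, y ∈ (tangentTriv n x).baseSet :=
  (tangentTriv n x).open_baseSet.mem_nhds (FiberBundle.mem_baseSet_trivializationAt' x)

/-- The matrix of an endomorphism of `T_y M` in the trivialization around `x`. -/
def endCoord (x : M) {y : M} (A : TangentSpace (𝓡 n) y →L[ℝ] TangentSpace (𝓡 n) y) :
    Euc n →L[ℝ] Euc n :=
  toCoord n x y ∘L A ∘L ofCoord n x y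

/-- A contravariant 2-tensor read in the trivialization around `x`. -/
def biCoord (x : M) {y : M} (K : BiContra (n := n) y) : (Euc n →L[ℝ] ℝ) →L[ℝ] Euc n :=
  toCoord n x y ∘L K ∘L ContinuousLinearMap.precomp ℝ (toCoord n x y)

theorem smoothEndField_iff {A : ∀ x : M, TangentSpace (𝓡 n) x →L[ℝ] TangentSpace (𝓡 n) x} :
    SmoothEndField A ↔
      ∀ x, ContMDiffAt (𝓡 n) 𝓘(ℝ, Euc n →L[ℝ] Euc n) ∞ (fun y ↦ endCoord x (A y)) x :=
  forall_congr' fun x ↦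
    (contMDiffAt_hom_bundle (IB := 𝓡 n) (IM := 𝓡 n) (n := ∞)
      (fun y ↦ TotalSpace.mk' (Euc n →L[ℝ] Euc n)
        (E := fun x : M ↦ TangentSpace (𝓡 n) x →L[ℝ] TangentSpace (𝓡 n) x) y (A y))
      (x₀ := x)).trans (and_iff_right contMDiffAt_id)

/-- The cotangent bundle is a hom bundle into the trivial line bundle, whose own trivialization is
the identity. This makes the bundle notion of smoothness for contravariant 2-tensors agree with
smoothness of `biCoord`. -/
theorem continuousLinearMapAt_cotangent {x y : M} (hy : y ∈ (tangentTriv n x).baseSet)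
    (p : TangentSpace (𝓡 n) y →L[ℝ] ℝ) :
    (trivializationAt (Euc n →L[ℝ] ℝ)
      (fun y : M ↦ TangentSpace (𝓡 n) y →L[ℝ] ℝ) x).continuousLinearMapAt ℝ y p
      = p ∘L ofCoord n x y := by
  set t := trivializationAt (Euc n →L[ℝ] ℝ) (fun y : M ↦ TangentSpace (𝓡 n) y →L[ℝ] ℝ) x with ht
  have hyt : y ∈ t.baseSet := ⟨hy, trivial⟩
  rw [Trivialization.continuousLinearMapAt_apply, t.coe_linearMapAt_of_mem hyt]
  have h := hom_trivializationAt_apply (RingHom.id ℝ) (F₁ := Euc n) (F₂ := ℝ)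
    (E₁ := fun y : M ↦ TangentSpace (𝓡 n) y) (E₂ := Bundle.Trivial M ℝ) x ⟨y, p⟩
  refine (congrArg Prod.snd h).trans ?_
  ext1 v
  exact DFunLike.congr_fun (Bundle.Trivial.continuousLinearMapAt_trivialization ℝ M ℝ y) _

theorem symmL_cotangent {x y : M} (hy : y ∈ (tangentTriv n x).baseSet) (r : Euc n →L[ℝ] ℝ) :
    (trivializationAt (Euc n →L[ℝ] ℝ) (fun y : M ↦ TangentSpace (𝓡 n) y →L[ℝ] ℝ) x).symmL ℝ y r
      = r ∘L toCoord n x y := by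
  set t := trivializationAt (Euc n →L[ℝ] ℝ) (fun y : M ↦ TangentSpace (𝓡 n) y →L[ℝ] ℝ) x with ht
  have hyt : y ∈ t.baseSet := ⟨hy, trivial⟩
  have h : t.continuousLinearMapAt ℝ y (r ∘L toCoord n x y) = r := by
    refine (continuousLinearMapAt_cotangent hy _).trans ?_
    ext v
    exact congrArg r (toCoord_ofCoord hy v)
  rw [← h, t.symmL_continuousLinearMapAt hyt, h]

theorem smoothBiContraField_iff {K : ∀ x : M, BiContra (n := n) x} :
    SmoothBiContraField K ↔
      ∀ x, ContMDiffAt (𝓡 n) 𝓘(ℝ, (Euc n →L[ℝ] ℝ) →L[ℝ] Euc n) ∞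
        (fun y ↦ biCoord x (K y)) x := by
  refine forall_congr' fun x ↦
    ((contMDiffAt_hom_bundle (IB := 𝓡 n) (IM := 𝓡 n) (n := ∞)
      (fun y ↦ TotalSpace.mk' ((Euc n →L[ℝ] ℝ) →L[ℝ] Euc n)
        (E := fun x : M ↦ (TangentSpace (𝓡 n) x →L[ℝ] ℝ) →L[ℝ] TangentSpace (𝓡 n) x) y (K y))
      (x₀ := x)).trans (and_iff_right contMDiffAt_id)).trans ?_
  refine Filter.EventuallyEq.contMDiffAt_iff ?_
  filter_upwards [eventually_mem_baseSet (n := n) x] with y hy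
  ext1 r
  exact congrArg (fun p ↦ toCoord n x y (K y p)) (symmL_cotangent hy r)

theorem endCoord_comp {x y : M} (hy : y ∈ (tangentTriv n x).baseSet)
    (A B : TangentSpace (𝓡 n) y →L[ℝ] TangentSpace (𝓡 n) y) :
    endCoord x (A ∘L B) = endCoord x A ∘L endCoord x B := by
  ext1 v
  simp only [endCoord, ContinuousLinearMap.comp_apply, ofCoord_toCoord hy]

theorem endCoord_id {x y : M} (hy : y ∈ (tangentTriv n x).baseSet) :
    endCoord x (ContinuousLinearMap.id ℝ (TangentSpace (𝓡 n) y))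
      = ContinuousLinearMap.id ℝ (Euc n) := by
  ext1 v
  exact toCoord_ofCoord hy v

theorem comp_inverse_self {V : Type*} [AddCommGroup V] [Module ℝ V] [TopologicalSpace V]
    {A : V →L[ℝ] V} (hA : A.IsInvertible) : A ∘L A.inverse = ContinuousLinearMap.id ℝ V := by
  obtain ⟨e, rfl⟩ := hA
  ext v
  simp

theorem inverse_comp_self {V : Type*} [AddCommGroup V] [Module ℝ V] [TopologicalSpace V]
    {A : V →L[ℝ] V} (hA : A.IsInvertible) : A.inverse ∘L A = ContinuousLinearMap.id ℝ V := by
  obtain ⟨e, rfl⟩ := hA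
  ext v
  simp

theorem endCoord_comp_inverse {x y : M} (hy : y ∈ (tangentTriv n x).baseSet)
    {A : TangentSpace (𝓡 n) y →L[ℝ] TangentSpace (𝓡 n) y} (hA : A.IsInvertible) :
    endCoord x A ∘L endCoord x A.inverse = ContinuousLinearMap.id ℝ (Euc n) := by
  rw [← endCoord_comp hy, comp_inverse_self hA, endCoord_id hy]

theorem endCoord_inverse_comp {x y : M} (hy : y ∈ (tangentTriv n x).baseSet)
    {A : TangentSpace (𝓡 n) y →L[ℝ] TangentSpace (𝓡 n) y} (hA : A.IsInvertible) :
    endCoord x A.inverse ∘L endCoord x A = ContinuousLinearMap.id ℝ (Euc n) := by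
  rw [← endCoord_comp hy, inverse_comp_self hA, endCoord_id hy]

/-- Inversion of a smooth family of invertible operators is smooth. -/
theorem contMDiffAt_inverse_of_comp_eq_id {E F : Type*} [NormedAddCommGroup E] [NormedSpace ℝ E]
    [NormedAddCommGroup F] [NormedSpace ℝ F] [CompleteSpace E] {A : M → E →L[ℝ] F}
    {B : M → F →L[ℝ] E} {x : M} (hA : ContMDiffAt (𝓡 n) 𝓘(ℝ, E →L[ℝ] F) ∞ A x)
    (hAB : ∀ᶠ y in nhds x, A y ∘L B y = ContinuousLinearMap.id ℝ F)
    (hBA : ∀ᶠ y in nhds x, B y ∘L A y = ContinuousLinearMap.id ℝ E) :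
    ContMDiffAt (𝓡 n) 𝓘(ℝ, F →L[ℝ] E) ∞ B x := by
  have h := contDiffAt_map_inverse (𝕜 := ℝ) (n := ∞)
    (ContinuousLinearEquiv.equivOfInverse' (A x) (B x) hAB.self_of_nhds hBA.self_of_nhds)
  have h2 : ContMDiffAt (𝓡 n) 𝓘(ℝ, F →L[ℝ] E) ∞ (fun y ↦ (A y).inverse) x :=
    ContMDiffAt.comp (I' := 𝓘(ℝ, E →L[ℝ] F)) (g := ContinuousLinearMap.inverse) x
      h.contMDiffAt hA
  refine h2.congr_of_eventuallyEq ?_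
  filter_upwards [hAB, hBA] with y h3 h4
  exact (ContinuousLinearMap.inverse_eq h3 h4).symm

theorem SmoothEndField.inverse {A : ∀ x : M, TangentSpace (𝓡 n) x →L[ℝ] TangentSpace (𝓡 n) x}
    (hA : SmoothEndField A) (h : ∀ x, (A x).IsInvertible) :
    SmoothEndField fun x ↦ (A x).inverse := by
  rw [smoothEndField_iff] at hA ⊢
  intro x
  refine contMDiffAt_inverse_of_comp_eq_id (hA x) ?_ ?_ <;>
    filter_upwards [eventually_mem_baseSet (n := n) x] with y hy
  · exact endCoord_comp_inverse hy (h y)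
  · exact endCoord_inverse_comp hy (h y)

/-- The operator `r ↦ r ∘ B` as a linear function of `B`. -/
def precompL (n : ℕ) : (Euc n →L[ℝ] Euc n) →L[ℝ] ((Euc n →L[ℝ] ℝ) →L[ℝ] (Euc n →L[ℝ] ℝ)) :=
  (ContinuousLinearMap.compL ℝ (Euc n) (Euc n) ℝ).flip

theorem biCoord_push {x y : M} (hy : y ∈ (tangentTriv n x).baseSet)
    (A B : TangentSpace (𝓡 n) y →L[ℝ] TangentSpace (𝓡 n) y) (K : BiContra (n := n) y) :
    biCoord x (BiContra.push A B K)
      = endCoord x A ∘L biCoord x K ∘L precompL n (endCoord x B) := by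
  ext1 r
  have h : (r ∘L toCoord n x y) ∘L B = (r ∘L endCoord x B) ∘L toCoord n x y := by
    ext v
    simp only [endCoord, ContinuousLinearMap.comp_apply, ofCoord_toCoord hy]
  change toCoord n x y (A (K ((r ∘L toCoord n x y) ∘L B)))
    = toCoord n x y (A (ofCoord n x y (toCoord n x y
      (K ((r ∘L endCoord x B) ∘L toCoord n x y)))))
  rw [ofCoord_toCoord hy, h]

set_option maxSynthPendingDepth 3 in
theorem SmoothBiContraField.push
    {A B : ∀ x : M, TangentSpace (𝓡 n) x →L[ℝ] TangentSpace (𝓡 n) x}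
    {K : ∀ x : M, BiContra (n := n) x} (hA : SmoothEndField A) (hB : SmoothEndField B)
    (hK : SmoothBiContraField K) :
    SmoothBiContraField fun x ↦ BiContra.push (A x) (B x) (K x) := by
  rw [smoothEndField_iff] at hA hB
  rw [smoothBiContraField_iff] at hK ⊢
  intro x
  have h : ContMDiffAt (𝓡 n) 𝓘(ℝ, (Euc n →L[ℝ] ℝ) →L[ℝ] (Euc n →L[ℝ] ℝ)) ∞
      (fun y ↦ precompL n (endCoord x (B y))) x :=
    ContMDiffAt.comp (I' := 𝓘(ℝ, Euc n →L[ℝ] Euc n)) (g := precompL n) x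
      (precompL n).contMDiff.contMDiffAt (hB x)
  refine ((hA x).clm_comp ((hK x).clm_comp h)).congr_of_eventuallyEq ?_
  filter_upwards [eventually_mem_baseSet (n := n) x] with y hy
  exact biCoord_push hy _ _ _

/-- The operator of `T_y M` with the given expression in the trivialization around `x`. -/
theorem exists_biCoord_eq {x y : M} (hy : y ∈ (tangentTriv n x).baseSet)
    (K : (Euc n →L[ℝ] ℝ) →L[ℝ] Euc n) : ∃ L : BiContra (n := n) y, biCoord x L = K := by
  refine ⟨ofCoord n x y ∘L K ∘L ContinuousLinearMap.precomp ℝ (ofCoord n x y), ?_⟩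
  ext1 r
  have h : (r ∘L toCoord n x y) ∘L ofCoord n x y = r := by
    ext v
    simp [toCoord_ofCoord hy]
  change toCoord n x y (ofCoord n x y (K ((r ∘L toCoord n x y) ∘L ofCoord n x y))) = K r
  rw [toCoord_ofCoord hy, h]

/-- The Lyapunov equation is invariant under linear changes of coordinates, so it passes to the
trivialization although the latter is not isometric. -/
theorem lyapunov_biCoord {x y : M} (hy : y ∈ (tangentTriv n x).baseSet)
    {A : TangentSpace (𝓡 n) y →L[ℝ] TangentSpace (𝓡 n) y} {J K : BiContra (n := n) y}
    (h : ∀ q : TangentSpace (𝓡 n) y →L[ℝ] ℝ, A (J q) + J (q ∘L A) = K q) :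
    lyapunov (endCoord x A) (biCoord x J) = biCoord x K := by
  ext1 r
  have h1 : (r ∘L toCoord n x y) ∘L A = (r ∘L endCoord x A) ∘L toCoord n x y := by
    ext v
    simp only [endCoord, ContinuousLinearMap.comp_apply, ofCoord_toCoord hy]
  have h2 := congrArg (toCoord n x y) (h (r ∘L toCoord n x y))
  rw [map_add, h1] at h2
  refine Eq.trans ?_ h2
  rw [lyapunov_apply]
  change toCoord n x y (A (ofCoord n x y (toCoord n x y (J (r ∘L toCoord n x y))))) + _ = _
  rw [ofCoord_toCoord hy]
  rfl

end Coordinates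

/-! ### Smoothness of the inverse metric, `Σ`, `J` and `L`. -/

section Metric

variable {n : ℕ} {M : Type*} [TopologicalSpace M] [ChartedSpace (Euc n) M] [IsManifold (𝓡 n) ∞ M]
  [RiemannianBundle (fun x : M ↦ TangentSpace (𝓡 n) x)]

/-- The integral solves the equation for an arbitrary right-hand side, so the operator is onto;
uniqueness then comes from finite dimension. -/
theorem isInvertible_lyapunov_endCoord {x y : M} (hy : y ∈ (tangentTriv n x).baseSet)
    {A : TangentSpace (𝓡 n) y →L[ℝ] TangentSpace (𝓡 n) y} (hA : ExpDecay A) :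
    (lyapunov (endCoord x A)).IsInvertible := by
  refine isInvertible_lyapunov_of_surjective fun K' ↦ ?_
  obtain ⟨K, rfl⟩ := exists_biCoord_eq hy K'
  exact ⟨_, lyapunov_biCoord hy (integralTensor_lyapunov hA K)⟩

variable {γ σ : ∀ x : M, TangentSpace (𝓡 n) x →L[ℝ] TangentSpace (𝓡 n) x}

set_option maxSynthPendingDepth 3 in
/-- `J` is smooth, because it is the solution of a Lyapunov equation with smooth coefficients. -/
theorem smoothBiContraField_tensorJ (hγ : SmoothEndField γ) (hdec : ∀ x, ExpDecay (γ x))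
    (hSigma : SmoothBiContraField (tensorSigma σ)) : SmoothBiContraField (tensorJ γ σ) := by
  rw [smoothEndField_iff] at hγ
  rw [smoothBiContraField_iff] at hSigma ⊢
  intro x
  have hx := FiberBundle.mem_baseSet_trivializationAt' (F := Euc n)
    (E := fun y : M ↦ TangentSpace (𝓡 n) y) x
  have hinv {y : M} (hy : y ∈ (tangentTriv n x).baseSet) :
      (lyapunov (endCoord x (γ y))).IsInvertible := isInvertible_lyapunov_endCoord hy (hdec y)
  have h1 : ContMDiffAt (𝓡 n)
      𝓘(ℝ, ((Euc n →L[ℝ] ℝ) →L[ℝ] Euc n) →L[ℝ] ((Euc n →L[ℝ] ℝ) →L[ℝ] Euc n)) ∞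
      (fun y ↦ lyapunov (endCoord x (γ y))) x :=
    ContMDiffAt.comp (I' := 𝓘(ℝ, Euc n →L[ℝ] Euc n)) (g := lyapunov) x
      contDiff_lyapunov.contMDiff.contMDiffAt (hγ x)
  have h2 := contMDiffAt_inverse_of_comp_eq_id
    (B := fun y ↦ (lyapunov (endCoord x (γ y))).inverse) h1
    ((eventually_mem_baseSet (n := n) x).mono fun y hy ↦ comp_inverse_self (hinv hy))
    ((eventually_mem_baseSet (n := n) x).mono fun y hy ↦ inverse_comp_self (hinv hy))
  -- Near `x`, `J` in coordinates is the inverse Lyapunov operator applied to `Σ`, both smooth.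
  refine (h2.clm_apply (hSigma x)).congr_of_eventuallyEq ?_
  filter_upwards [eventually_mem_baseSet (n := n) x] with y hy
  rw [← lyapunov_biCoord hy (integralTensor_lyapunov (hdec y) (tensorSigma σ y))]
  exact (congrArg (fun B ↦ B (biCoord x (tensorJ γ σ y))) (inverse_comp_self (hinv hy))).symm

theorem innerSL_inverseMetric (x : M) (p : TangentSpace (𝓡 n) x →L[ℝ] ℝ) :
    innerSL ℝ (inverseMetric x p) = p := by
  have : CompleteSpace (TangentSpace (𝓡 n) x) := FiniteDimensional.complete ℝ _
  obtain ⟨v, rfl⟩ := (InnerProductSpace.toDual ℝ (TangentSpace (𝓡 n) x)).surjective p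
  exact congrArg (innerSL ℝ) (inverseMetric_innerSL x v)

/-- The metric read in the trivialization around `x`. -/
def metricCoord (x y : M) : Euc n →L[ℝ] (Euc n →L[ℝ] ℝ) :=
  ContinuousLinearMap.precomp ℝ (ofCoord n x y) ∘L (innerSL ℝ (E := TangentSpace (𝓡 n) y))
    ∘L ofCoord n x y

variable [IsContMDiffRiemannianBundle (𝓡 n) ∞ (Euc n) (fun x : M ↦ TangentSpace (𝓡 n) x)]

theorem contMDiffAt_metricCoord (x : M) :
    ContMDiffAt (𝓡 n) 𝓘(ℝ, Euc n →L[ℝ] (Euc n →L[ℝ] ℝ)) ∞ (metricCoord (n := n) x) x := by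
  obtain ⟨g, hg, hinner⟩ := IsContMDiffRiemannianBundle.exists_contMDiff (IB := 𝓡 n) (n := ∞)
    (F := Euc n) (E := fun x : M ↦ TangentSpace (𝓡 n) x)
  have h := ((contMDiffAt_hom_bundle (IB := 𝓡 n) (IM := 𝓡 n) (n := ∞)
      (fun y ↦ TotalSpace.mk' (Euc n →L[ℝ] (Euc n →L[ℝ] ℝ))
        (E := fun x : M ↦ TangentSpace (𝓡 n) x →L[ℝ] (TangentSpace (𝓡 n) x →L[ℝ] ℝ)) y (g y))
      (x₀ := x)).1 (hg x)).2
  refine h.congr_of_eventuallyEq ?_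
  filter_upwards [eventually_mem_baseSet (n := n) x] with y hy
  ext1 r
  refine Eq.trans ?_ (continuousLinearMapAt_cotangent hy (g y (ofCoord n x y r))).symm
  ext v
  exact hinner y _ _

/-- In coordinates the inverse metric is the two-sided inverse of the smooth operator `metricCoord`.
-/
theorem smoothBiContraField_inverseMetric :
    SmoothBiContraField (n := n) (M := M) inverseMetric := by
  rw [smoothBiContraField_iff]
  intro x
  refine contMDiffAt_inverse_of_comp_eq_id (contMDiffAt_metricCoord x) ?_ ?_ <;>
    filter_upwards [eventually_mem_baseSet (n := n) x] with y hy
  · ext r v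
    change innerSL ℝ (ofCoord n x y (toCoord n x y (inverseMetric y (r ∘L toCoord n x y))))
      (ofCoord n x y v) = r v
    rw [ofCoord_toCoord hy, innerSL_inverseMetric]
    exact congrArg r (toCoord_ofCoord hy v)
  · ext1 v
    have h : (innerSL ℝ (ofCoord n x y v) ∘L ofCoord n x y) ∘L toCoord n x y
        = innerSL ℝ (ofCoord n x y v) := by
      ext w
      exact congrArg (innerSL ℝ (ofCoord n x y v)) (ofCoord_toCoord hy w)
    change toCoord n x y (inverseMetric y
      ((innerSL ℝ (ofCoord n x y v) ∘L ofCoord n x y) ∘L toCoord n x y)) = v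
    rw [h, inverseMetric_innerSL, toCoord_ofCoord hy]

theorem smoothBiContraField_tensorSigma (hσ : SmoothEndField σ) :
    SmoothBiContraField (tensorSigma σ) :=
  smoothBiContraField_inverseMetric.push hσ hσ

theorem smoothBiContraField_tensorL (hγ : SmoothEndField γ) (hdec : ∀ x, ExpDecay (γ x))
    (hσ : SmoothEndField σ) : SmoothBiContraField (tensorL γ σ) := by
  rw [show tensorL γ σ = fun x ↦ BiContra.push (inverseField γ x) (γ x) (tensorJ γ σ x) from
    funext fun x ↦ tensorL_eq_push (hdec x)]
  exact (smoothBiContraField_tensorJ hγ hdec (smoothBiContraField_tensorSigma hσ)).push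
    (hγ.inverse fun x ↦ (hdec x).isInvertible) hγ

end Metric

/-! ### Vertical and horizontal vectors and frame matrices in coordinates. -/

section FrameCoordinates

variable {n : ℕ} {M : Type*} [TopologicalSpace M] [ChartedSpace (Euc n) M] [IsManifold (𝓡 n) ∞ M]

/-- A frame read in the trivialization of the tangent bundle around `x`. -/
def frameCoord (x : M) (u : FrameSpace n M) : Euc n →L[ℝ] Euc n :=
  toCoord n x u.proj ∘L u.2

theorem inCoordinates_frame (x y : M) (u : Euc n →L[ℝ] TangentSpace (𝓡 n) y) :
    ContinuousLinearMap.inCoordinates (Euc n) (Bundle.Trivial M (Euc n)) (Euc n)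
      (fun y : M ↦ TangentSpace (𝓡 n) y) x y x y u = toCoord n x y ∘L u := by
  ext1 v
  exact congrArg (fun w ↦ toCoord n x y (u w))
    (DFunLike.congr_fun (Bundle.Trivial.symmL_trivialization ℝ M (Euc n) y) v)

theorem contMDiffAt_frameCoord (u : FrameSpace n M) :
    ContMDiffAt (frameModel n) 𝓘(ℝ, Euc n →L[ℝ] Euc n) ∞ (frameCoord u.proj) u := by
  have h := ((contMDiffAt_hom_bundle (IB := 𝓡 n) (IM := frameModel n) (n := ∞)
    (E₁ := Bundle.Trivial M (Euc n)) (E₂ := fun y : M ↦ TangentSpace (𝓡 n) y)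
    (fun u : FrameSpace n M ↦ u) (x₀ := u)).1 contMDiffAt_id).2
  exact h.congr_of_eventuallyEq (.of_forall fun u' ↦ (inCoordinates_frame _ _ _).symm)

theorem contMDiffAt_frameProj (u : FrameSpace n M) :
    ContMDiffAt (frameModel n) (𝓡 n) ∞ (fun u' : FrameSpace n M ↦ u'.proj) u :=
  Bundle.contMDiffAt_proj (fun y : M ↦ Euc n →L[ℝ] TangentSpace (𝓡 n) y)

/-- The inclusion of the fibre of the frame space over `x`, in coordinates. -/
def fiberInclusion (x : M) (B : Euc n →L[ℝ] Euc n) : FrameSpace n M :=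
  ⟨x, ofCoord n x x ∘L B⟩

theorem mem_baseSet_self (x : M) : x ∈ (tangentTriv n x).baseSet :=
  FiberBundle.mem_baseSet_trivializationAt' x

theorem contMDiff_fiberInclusion (x : M) :
    ContMDiff 𝓘(ℝ, Euc n →L[ℝ] Euc n) (frameModel n) ∞ (fiberInclusion (n := n) x) := by
  intro B
  refine (contMDiffAt_hom_bundle (IB := 𝓡 n) (IM := 𝓘(ℝ, Euc n →L[ℝ] Euc n)) (n := ∞)
    (E₁ := Bundle.Trivial M (Euc n)) (E₂ := fun y : M ↦ TangentSpace (𝓡 n) y)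
    (fiberInclusion x) (x₀ := B)).2 ⟨contMDiffAt_const, ?_⟩
  refine contMDiffAt_id.congr_of_eventuallyEq (.of_forall fun B' ↦ ?_)
  refine (inCoordinates_frame _ _ _).trans ?_
  ext1 v
  exact toCoord_ofCoord (mem_baseSet_self x) _

theorem fiberInclusion_toCoord (u : FrameSpace n M) (A : Euc n →L[ℝ] TangentSpace (𝓡 n) u.proj)
    (t : ℝ) :
    fiberInclusion u.proj (frameCoord u.proj u + t • (toCoord n u.proj u.proj ∘L A))
      = ⟨u.proj, u.2 + t • A⟩ := by
  refine congrArg (TotalSpace.mk u.proj) ?_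
  ext1 v
  have h := ofCoord_toCoord (n := n) (mem_baseSet_self u.proj)
  change ofCoord n u.proj u.proj (toCoord n u.proj u.proj (u.2 v)
    + t • toCoord n u.proj u.proj (A v)) = u.2 v + t • A v
  rw [map_add, map_smul, h, h]

/-- The model of the tangent spaces of the frame space. -/
abbrev FrameVec (n : ℕ) : Type := Euc n × (Euc n →L[ℝ] Euc n)

/-- The vertical lift in coordinates. -/
def verticalMap (u : FrameSpace n M) : (Euc n →L[ℝ] Euc n) →L[ℝ] FrameVec n :=
  mfderiv 𝓘(ℝ, Euc n →L[ℝ] Euc n) (frameModel n) (fiberInclusion u.proj) (frameCoord u.proj u)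

theorem hasMFDerivAt_vertical (u : FrameSpace n M)
    (A : Euc n →L[ℝ] TangentSpace (𝓡 n) u.proj) :
    HasMFDerivAt 𝓘(ℝ, ℝ) (frameModel n)
      (fun t : ℝ ↦ (⟨u.proj, u.2 + t • A⟩ : FrameSpace n M)) 0
      ((verticalMap u).comp
        (ContinuousLinearMap.toSpanSingleton ℝ (toCoord n u.proj u.proj ∘L A))) := by
  have h1 : HasMFDerivAt 𝓘(ℝ, ℝ) 𝓘(ℝ, Euc n →L[ℝ] Euc n)
      (fun t : ℝ ↦ frameCoord u.proj u + t • (toCoord n u.proj u.proj ∘L A)) 0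
      (ContinuousLinearMap.toSpanSingleton ℝ (toCoord n u.proj u.proj ∘L A)) := by
    refine HasFDerivAt.hasMFDerivAt ?_
    have := ((hasDerivAt_id (0 : ℝ)).smul_const (toCoord n u.proj u.proj ∘L A)).const_add
      (frameCoord u.proj u)
    rw [one_smul] at this
    exact this.hasFDerivAt
  -- The base point is left free because the curve starts at `frameCoord u.proj u + 0 • _`.
  have h2 (B : Euc n →L[ℝ] Euc n) (hB : B = frameCoord u.proj u) :
      HasMFDerivAt 𝓘(ℝ, Euc n →L[ℝ] Euc n) (frameModel n) (fiberInclusion u.proj) B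
        (verticalMap u) := by
    subst hB
    exact ((contMDiff_fiberInclusion (n := n) u.proj
      (frameCoord u.proj u)).mdifferentiableAt (by simp)).hasMFDerivAt
  refine ((h2 _ ((congrArg _ (zero_smul ℝ _)).trans (add_zero _))).comp (0 : ℝ) h1).congr_of_eventuallyEq ?_
  exact .of_forall fun t ↦ (fiberInclusion_toCoord u A t).symm

theorem verticalLift_eq (u : FrameSpace n M) (A : Euc n →L[ℝ] TangentSpace (𝓡 n) u.proj) :
    (verticalLift u A : FrameVec n) = verticalMap u (toCoord n u.proj u.proj ∘L A) := by
  refine (DFunLike.congr_fun (hasMFDerivAt_vertical u A).mfderiv (1 : ℝ)).trans ?_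
  change verticalMap u ((1 : ℝ) • (toCoord n u.proj u.proj ∘L A)) = _
  rw [one_smul]

variable (cov : CovariantDerivative (𝓡 n) (Euc n) (fun x : M ↦ TangentSpace (𝓡 n) x))

/-- The derivative of the local section through `u`. -/
def sectionDeriv (u : FrameSpace n M) : TangentSpace (𝓡 n) u.proj →L[ℝ] FrameVec n :=
  mfderiv (𝓡 n) (frameModel n) (fun y : M ↦ (⟨y, FiberBundle.extend (Euc n →L[ℝ] Euc n)
      (E := fun x : M ↦ Euc n →L[ℝ] TangentSpace (𝓡 n) x) u.2 y⟩ : FrameSpace n M)) u.proj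

theorem nablaFrame_add (s : ∀ y : M, Euc n →L[ℝ] TangentSpace (𝓡 n) y) (x : M)
    (v w : TangentSpace (𝓡 n) x) :
    nablaFrame cov s x (v + w) = nablaFrame cov s x v + nablaFrame cov s x w := by
  ext1 z
  simp only [nablaFrame, map_add, sum_apply, add_apply, ContinuousLinearMap.smulRight_apply,
    smul_add, Finset.sum_add_distrib]

theorem nablaFrame_smul (s : ∀ y : M, Euc n →L[ℝ] TangentSpace (𝓡 n) y) (x : M) (c : ℝ)
    (v : TangentSpace (𝓡 n) x) :
    nablaFrame cov s x (c • v) = c • nablaFrame cov s x v := by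
  ext1 z
  simp only [nablaFrame, map_smul, sum_apply, smul_apply, ContinuousLinearMap.smulRight_apply,
    Finset.smul_sum]
  exact Finset.sum_congr rfl fun i _ ↦ smul_comm _ _ _

/-- The horizontal lift to the frame `u` as a linear map. -/
def horizontalLiftLinear (u : FrameSpace n M) :
    TangentSpace (𝓡 n) u.proj →ₗ[ℝ] FrameVec n where
  toFun w := horizontalLift cov u w
  map_add' v w := by
    have h (w : TangentSpace (𝓡 n) u.proj) : (horizontalLift cov u w : FrameVec n)
        = sectionDeriv u w - verticalMap u (toCoord n u.proj u.proj ∘L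
          nablaFrame cov (FiberBundle.extend (Euc n →L[ℝ] Euc n)
            (E := fun x : M ↦ Euc n →L[ℝ] TangentSpace (𝓡 n) x) u.2) u.proj w) :=
      congrArg (fun a : FrameVec n ↦ sectionDeriv u w - a) (verticalLift_eq u _)
    rw [h, h, h, nablaFrame_add, ContinuousLinearMap.comp_add,
      (sectionDeriv u).map_add, (verticalMap u).map_add]
    abel
  map_smul' c v := by
    have h (w : TangentSpace (𝓡 n) u.proj) : (horizontalLift cov u w : FrameVec n)
        = sectionDeriv u w - verticalMap u (toCoord n u.proj u.proj ∘L
          nablaFrame cov (FiberBundle.extend (Euc n →L[ℝ] Euc n)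
            (E := fun x : M ↦ Euc n →L[ℝ] TangentSpace (𝓡 n) x) u.2) u.proj w) :=
      congrArg (fun a : FrameVec n ↦ sectionDeriv u w - a) (verticalLift_eq u _)
    rw [h, h, nablaFrame_smul, ContinuousLinearMap.comp_smul,
      (sectionDeriv u).map_smul, (verticalMap u).map_smul]
    exact (smul_sub c _ _).symm

variable {A : ∀ x : M, TangentSpace (𝓡 n) x →L[ℝ] TangentSpace (𝓡 n) x}

theorem toCoord_comp_inverse {x y : M} (hy : y ∈ (tangentTriv n x).baseSet)
    (u : Euc n →L[ℝ] TangentSpace (𝓡 n) y) (w : TangentSpace (𝓡 n) y) :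
    (toCoord n x y ∘L u).inverse (toCoord n x y w) = u.inverse w := by
  let e := (tangentTriv n x).continuousLinearEquivAt ℝ y hy
  have he : toCoord n x y = (e : TangentSpace (𝓡 n) y →L[ℝ] Euc n) := by
    ext1 v
    simp [e, toCoord, Trivialization.coe_linearMapAt_of_mem _ hy]
  rw [he, ContinuousLinearMap.inverse_equiv_comp]
  simp

/-- The matrix of `A` in a frame depends smoothly on the frame. -/
theorem contMDiffAt_frameMatrix (hA : SmoothEndField A) {u : FrameSpace n M}
    (hu : u.2.IsInvertible) (i j : Fin n) :
    ContMDiffAt (frameModel n) 𝓘(ℝ, ℝ) ∞ (fun u' ↦ frameMatrix A u' i j) u := by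
  rw [smoothEndField_iff] at hA
  have hinv : (frameCoord u.proj u).IsInvertible := by
    obtain ⟨e, he⟩ := hu
    let e' := (tangentTriv n u.proj).continuousLinearEquivAt ℝ u.proj (mem_baseSet_self u.proj)
    refine ⟨e.trans e', ?_⟩
    ext1 v
    simp [e', frameCoord, toCoord,
      Trivialization.coe_linearMapAt_of_mem _ (mem_baseSet_self (n := n) u.proj), ← he]
  obtain ⟨e, he⟩ := hinv
  have h1 := contMDiffAt_frameCoord u
  have h2 : ContMDiffAt (frameModel n) 𝓘(ℝ, Euc n →L[ℝ] Euc n) ∞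
      (fun u' ↦ (frameCoord u.proj u').inverse) u := by
    refine ContMDiffAt.comp (I' := 𝓘(ℝ, Euc n →L[ℝ] Euc n)) (g := ContinuousLinearMap.inverse) u
      ?_ h1
    rw [← he]
    exact (contDiffAt_map_inverse e).contMDiffAt
  have h3 : ContMDiffAt (frameModel n) 𝓘(ℝ, Euc n →L[ℝ] Euc n) ∞
      (fun u' : FrameSpace n M ↦ endCoord u.proj (A u'.proj)) u :=
    ContMDiffAt.comp (I' := 𝓡 n) (g := fun y ↦ endCoord u.proj (A y)) u (hA u.proj)
      (contMDiffAt_frameProj u)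
  -- With everything read in one trivialization, `u⁻¹ A u` is a product of three smooth matrix
  -- functions; the trivialization maps cancel.
  have h4 := h2.clm_apply (h3.clm_apply (h1.clm_apply (contMDiffAt_const (c := stdVec j))))
  have h5 := ContMDiffAt.comp (I' := 𝓘(ℝ, Euc n)) (g := (EuclideanSpace.proj i : Euc n →L[ℝ] ℝ)) u
    (EuclideanSpace.proj i : Euc n →L[ℝ] ℝ).contMDiff.contMDiffAt h4
  refine h5.congr_of_eventuallyEq ?_
  filter_upwards [(contMDiffAt_frameProj u).continuousAt.eventually
    (eventually_mem_baseSet (n := n) u.proj)] with u' hu'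
  refine congrArg (fun v : Euc n ↦ v i) ?_
  change _ = (toCoord n u.proj u'.proj ∘L u'.2).inverse (toCoord n u.proj u'.proj
    (A u'.proj (ofCoord n u.proj u'.proj (toCoord n u.proj u'.proj (u'.2 (stdVec j))))))
  rw [ofCoord_toCoord hu', toCoord_comp_inverse hu']

end FrameCoordinates

/-! ### Tensoriality of the covariant derivative of a `(1,1)`-tensor field. -/

section Connection

variable {n : ℕ} {M : Type*} [TopologicalSpace M] [ChartedSpace (Euc n) M] [IsManifold (𝓡 n) ∞ M]
  (cov : CovariantDerivative (𝓡 n) (Euc n) (fun x : M ↦ TangentSpace (𝓡 n) x))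
  {A : ∀ x : M, TangentSpace (𝓡 n) x →L[ℝ] TangentSpace (𝓡 n) x}

variable (n) in
/-- Differentiability of a vector field at a point. -/
abbrev DiffVF (W : ∀ x : M, TangentSpace (𝓡 n) x) (x : M) : Prop :=
  MDifferentiableAt (𝓡 n) ((𝓡 n).prod 𝓘(ℝ, Euc n))
    (fun y ↦ TotalSpace.mk' (Euc n) (E := fun x : M ↦ TangentSpace (𝓡 n) x) y (W y)) x

theorem SmoothEndField.diffVF (hA : SmoothEndField A) {W : ∀ x : M, TangentSpace (𝓡 n) x} {x : M}
    (hW : DiffVF n W x) : DiffVF n (fun y ↦ A y (W y)) x :=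
  MDifferentiableAt.clm_bundle_apply (F₁ := Euc n) (F₂ := Euc n)
    ((hA x).mdifferentiableAt (by simp)) hW

theorem cov_add {W W' : ∀ x : M, TangentSpace (𝓡 n) x} {x : M}
    (hW : DiffVF n W x) (hW' : DiffVF n W' x) :
    cov (fun y ↦ W y + W' y) x = cov W x + cov W' x :=
  cov.isCovariantDerivativeOnUniv.add hW hW'

/-- The differential of a function, as a covector. -/
def dfun (f : M → ℝ) (x : M) : TangentSpace (𝓡 n) x →L[ℝ] ℝ :=
  mfderiv (𝓡 n) 𝓘(ℝ, ℝ) f x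

theorem cov_smul {W : ∀ x : M, TangentSpace (𝓡 n) x} {f : M → ℝ} {x : M}
    (hW : DiffVF n W x) (hf : MDifferentiableAt (𝓡 n) 𝓘(ℝ, ℝ) f x) (v : TangentSpace (𝓡 n) x) :
    cov (fun y ↦ f y • W y) x v
      = f x • cov W x v + dfun f x v • W x :=
  DFunLike.congr_fun (cov.isCovariantDerivativeOnUniv.leibniz hW hf) v

theorem cov_sum {ι : Type*} (s : Finset ι) {W : ι → ∀ x : M, TangentSpace (𝓡 n) x} {x : M}
    (hW : ∀ i ∈ s, DiffVF n (W i) x) :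
    cov (fun y ↦ ∑ i ∈ s, W i y) x = ∑ i ∈ s, cov (W i) x := by
  classical
  induction s using Finset.induction_on with
  | empty =>
    simp only [Finset.sum_empty]
    exact congrFun cov.zero x
  | insert a s ha ih =>
    have hs : ∀ i ∈ s, DiffVF n (W i) x := fun i hi ↦ hW i (Finset.mem_insert_of_mem hi)
    simp only [Finset.sum_insert ha, ← ih hs]
    exact cov_add cov (hW a (Finset.mem_insert_self a s)) (.sum_section hs)

/-- `W ↦ ∇(A W) - A ∇W` is tensorial. -/
theorem tensorialAt_nablaEnd (hA : SmoothEndField A) (x : M) :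
    TensorialAt (𝓡 n) (Euc n) (fun W : ∀ x : M, TangentSpace (𝓡 n) x ↦
      cov (fun y ↦ A y (W y)) x - A x ∘L cov W x) x where
  smul {f W} hf hW := by
    ext1 v
    have h1 := cov_smul cov (hA.diffVF hW) hf v
    have h2 := cov_smul cov hW hf v
    have h3 : (fun y ↦ A y ((f • W) y)) = fun y ↦ f y • A y (W y) :=
      funext fun y ↦ map_smul (A y) (f y) (W y)
    rw [h3]
    change cov (fun y ↦ f y • A y (W y)) x v - A x (cov (fun y ↦ f y • W y) x v)
      = f x • (cov (fun y ↦ A y (W y)) x v - A x (cov W x v))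
    -- The Leibniz terms `df(v) A W` from the two summands cancel.
    rw [h1, h2, map_add, map_smul, map_smul, smul_sub]
    abel
  add {W W'} hW hW' := by
    have h3 : (fun y ↦ A y ((W + W') y)) = fun y ↦ A y (W y) + A y (W' y) :=
      funext fun y ↦ map_add (A y) (W y) (W' y)
    have h4 : cov (W + W') x = cov W x + cov W' x := cov_add cov hW hW'
    rw [h3, h4, cov_add cov (hA.diffVF hW) (hA.diffVF hW'), ContinuousLinearMap.comp_add]
    abel

/-- The covariant derivative of a `(1,1)`-tensor field at a point, as a bilinear map. -/
def nablaHom (hA : SmoothEndField A) (x : M) :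
    TangentSpace (𝓡 n) x →L[ℝ] TangentSpace (𝓡 n) x →L[ℝ] TangentSpace (𝓡 n) x :=
  TensorialAt.mkHom _ x (tensorialAt_nablaEnd cov hA x)

theorem nablaEnd_eq (hA : SmoothEndField A) {x : M} {W : ∀ x : M, TangentSpace (𝓡 n) x}
    (hW : DiffVF n W x) (v : TangentSpace (𝓡 n) x) :
    nablaEnd cov A x v (W x) = cov (fun y ↦ A y (W y)) x v - A x (cov W x v) :=
  DFunLike.congr_fun (TensorialAt.mkHom_apply (tensorialAt_nablaEnd cov hA x) hW) v

end Connection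

/-! ### Horizontal derivatives of frame components. -/

section FrameDerivative

variable {n : ℕ} {M : Type*} [TopologicalSpace M] [ChartedSpace (Euc n) M]

/-- The basis `u e_i` of the tangent space given by a frame `u`. -/
def frameBasis {u : FrameSpace n M} (hu : u.2.IsInvertible) :
    Module.Basis (Fin n) ℝ (TangentSpace (𝓡 n) u.proj) :=
  (EuclideanSpace.basisFun (Fin n) ℝ).toBasis.map hu.choose.toLinearEquiv

theorem frameBasis_apply {u : FrameSpace n M} (hu : u.2.IsInvertible) (i : Fin n) :
    frameBasis hu i = u.2 (stdVec i) := by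
  conv_rhs => rw [← hu.choose_spec]
  simp [frameBasis, stdVec]

theorem dualVec_frameBasis {u : FrameSpace n M} (hu : u.2.IsInvertible) (i : Fin n)
    (v : TangentSpace (𝓡 n) u.proj) : dualVec (frameBasis hu) i v = u.2.inverse v i := by
  have h : u.2.inverse v = hu.choose.symm v := by
    conv_lhs => rw [← hu.choose_spec]
    simp
  rw [h]
  simp [dualVec, frameBasis]

theorem frameMatrix_eq_endComp
    (A : ∀ x : M, TangentSpace (𝓡 n) x →L[ℝ] TangentSpace (𝓡 n) x)
    {u : FrameSpace n M} (hu : u.2.IsInvertible) (i j : Fin n) :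
    frameMatrix A u i j = endComp (A u.proj) (frameBasis hu) i j := by
  rw [endComp, dualVec_frameBasis, frameBasis_apply]
  rfl

/-- This relation determines the frame matrix without inverting `u`; it is the one differentiated
along fibres and along sections. -/
theorem sum_frameMatrix_smul (A : ∀ x : M, TangentSpace (𝓡 n) x →L[ℝ] TangentSpace (𝓡 n) x)
    {u : FrameSpace n M} (hu : u.2.IsInvertible) (j : Fin n) :
    ∑ i, frameMatrix A u i j • u.2 (stdVec i) = A u.proj (u.2 (stdVec j)) := by
  have h := sum_dualVec_smul (frameBasis hu) (A u.proj (u.2 (stdVec j)))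
  simpa only [frameMatrix_eq_endComp A hu, endComp, frameBasis_apply] using h

variable [IsManifold (𝓡 n) ∞ M]

theorem extend_tangent {x y : M} (hy : y ∈ (tangentTriv n x).baseSet) (v : TangentSpace (𝓡 n) x) :
    FiberBundle.extend (Euc n) (E := fun x : M ↦ TangentSpace (𝓡 n) x) v y
      = ofCoord n x y (toCoord n x x v) := by
  simp only [FiberBundle.extend, ofCoord, toCoord, Trivialization.symmL_apply _ hy,
    Trivialization.continuousLinearMapAt_apply,
    Trivialization.coe_linearMapAt_of_mem _ (mem_baseSet_self (n := n) x)]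

theorem symmL_frame {x y : M} (hy : y ∈ (tangentTriv n x).baseSet) (B : Euc n →L[ℝ] Euc n) :
    (trivializationAt (Euc n →L[ℝ] Euc n)
      (fun y : M ↦ Euc n →L[ℝ] TangentSpace (𝓡 n) y) x).symmL ℝ y B = ofCoord n x y ∘L B := by
  set t := trivializationAt (Euc n →L[ℝ] Euc n)
    (fun y : M ↦ Euc n →L[ℝ] TangentSpace (𝓡 n) y) x with ht
  have hyt : y ∈ t.baseSet := ⟨trivial, hy⟩
  have h : t.continuousLinearMapAt ℝ y (ofCoord n x y ∘L B) = B := by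
    rw [Trivialization.continuousLinearMapAt_apply, t.coe_linearMapAt_of_mem hyt]
    have h := hom_trivializationAt_apply (RingHom.id ℝ) (F₁ := Euc n) (F₂ := Euc n)
      (E₁ := Bundle.Trivial M (Euc n)) (E₂ := fun y : M ↦ TangentSpace (𝓡 n) y) x
      ⟨y, ofCoord n x y ∘L B⟩
    refine (congrArg Prod.snd h).trans ((inCoordinates_frame _ _ _).trans ?_)
    ext1 v
    exact toCoord_ofCoord hy (B v)
  rw [← h, t.symmL_continuousLinearMapAt hyt, h]

/-- The local section of the frame space through `u`. -/
abbrev frameSection (u : FrameSpace n M) : ∀ y : M, Euc n →L[ℝ] TangentSpace (𝓡 n) y :=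
  FiberBundle.extend (Euc n →L[ℝ] Euc n)
    (E := fun x : M ↦ Euc n →L[ℝ] TangentSpace (𝓡 n) x) u.2

theorem frameSection_eq (u : FrameSpace n M) {y : M} (hy : y ∈ (tangentTriv n u.proj).baseSet) :
    frameSection u y = ofCoord n u.proj y ∘L frameCoord u.proj u := by
  have hyt : y ∈ (trivializationAt (Euc n →L[ℝ] Euc n)
      (fun y : M ↦ Euc n →L[ℝ] TangentSpace (𝓡 n) y) u.proj).baseSet := ⟨trivial, hy⟩
  rw [← symmL_frame hy, frameSection, FiberBundle.extend, Trivialization.symmL_apply _ hyt]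
  refine congrArg _ ?_
  have h := hom_trivializationAt_apply (RingHom.id ℝ) (F₁ := Euc n) (F₂ := Euc n)
      (E₁ := Bundle.Trivial M (Euc n)) (E₂ := fun y : M ↦ TangentSpace (𝓡 n) y) u.proj u
  exact (congrArg Prod.snd h).trans (inCoordinates_frame _ _ _)

/-- Both extensions are constant in the tangent trivialization around `u.proj`, so the columns of
the section of frames are the extensions of the columns of `u`. -/
theorem frameSection_apply (u : FrameSpace n M) {y : M}
    (hy : y ∈ (tangentTriv n u.proj).baseSet) (v : Euc n) :
    frameSection u y v
      = FiberBundle.extend (Euc n) (E := fun x : M ↦ TangentSpace (𝓡 n) x) (u.2 v) y := by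
  rw [frameSection_eq u hy, extend_tangent hy]
  rfl

theorem isInvertible_toCoord_comp {x y : M} (hy : y ∈ (tangentTriv n x).baseSet)
    {u : Euc n →L[ℝ] TangentSpace (𝓡 n) y} :
    (toCoord n x y ∘L u).IsInvertible ↔ u.IsInvertible := by
  let e := (tangentTriv n x).continuousLinearEquivAt ℝ y hy
  have he : toCoord n x y = (e : TangentSpace (𝓡 n) y →L[ℝ] Euc n) := by
    ext1 v
    simp [e, toCoord, Trivialization.coe_linearMapAt_of_mem _ hy]
  rw [he, ContinuousLinearMap.isInvertible_equiv_comp]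

/-- Derivatives at `u` see all nearby points of the frame space, and identities for frame matrices
hold only at invertible ones; invertibility is an open condition. -/
theorem eventually_isInvertible {u : FrameSpace n M} (hu : u.2.IsInvertible) :
    ∀ᶠ u' : FrameSpace n M in nhds u, u'.2.IsInvertible := by
  obtain ⟨e, he⟩ := (isInvertible_toCoord_comp (mem_baseSet_self (n := n) u.proj)).2 hu
  have h := (contMDiffAt_frameCoord u).continuousAt.eventually_mem
    (s := Set.range ((↑) : (Euc n ≃L[ℝ] Euc n) → Euc n →L[ℝ] Euc n))
    (by rw [frameCoord, ← he]; exact ContinuousLinearEquiv.nhds e)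
  filter_upwards [h, (contMDiffAt_frameProj u).continuousAt.eventually
    (eventually_mem_baseSet (n := n) u.proj)] with u' h' hy
  exact (isInvertible_toCoord_comp hy).1 h'

theorem frameSection_self (u : FrameSpace n M) : frameSection u u.proj = u.2 := by
  rw [frameSection_eq u (mem_baseSet_self _)]
  ext1 v
  exact ofCoord_toCoord (mem_baseSet_self _) _

theorem isInvertible_frameSection {u : FrameSpace n M} (hu : u.2.IsInvertible) {y : M}
    (hy : y ∈ (tangentTriv n u.proj).baseSet) : (frameSection u y).IsInvertible := by
  rw [← isInvertible_toCoord_comp hy, frameSection_eq u hy]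
  have : toCoord n u.proj y ∘L ofCoord n u.proj y ∘L frameCoord u.proj u
      = toCoord n u.proj u.proj ∘L u.2 := by
    ext1 v
    exact toCoord_ofCoord hy _
  rw [this]
  exact (isInvertible_toCoord_comp (mem_baseSet_self _)).2 hu

variable (cov : CovariantDerivative (𝓡 n) (Euc n) (fun x : M ↦ TangentSpace (𝓡 n) x))
  {A : ∀ x : M, TangentSpace (𝓡 n) x →L[ℝ] TangentSpace (𝓡 n) x}

/-- The differential of a function on the frame space. -/
def frameDiff (f : FrameSpace n M → ℝ) (u : FrameSpace n M) : FrameVec n →L[ℝ] ℝ :=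
  mfderiv (frameModel n) 𝓘(ℝ, ℝ) f u

/-- The vector field around `u.proj` that extends `u e_i`. -/
abbrev frameExt (u : FrameSpace n M) (i : Fin n) : ∀ y : M, TangentSpace (𝓡 n) y :=
  FiberBundle.extend (Euc n) (E := fun x : M ↦ TangentSpace (𝓡 n) x) (u.2 (stdVec i))

theorem diffVF_extend {x : M} (v : TangentSpace (𝓡 n) x) :
    DiffVF n (FiberBundle.extend (Euc n) (E := fun x : M ↦ TangentSpace (𝓡 n) x) v) x :=
  FiberBundle.mdifferentiableAt_extend (𝓡 n) (Euc n) v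

theorem hasMFDerivAt_frameSection (u : FrameSpace n M) :
    HasMFDerivAt (𝓡 n) (frameModel n) (fun y : M ↦ (⟨y, frameSection u y⟩ : FrameSpace n M)) u.proj
      (sectionDeriv u) :=
  (FiberBundle.mdifferentiableAt_extend (𝓡 n) (Euc n →L[ℝ] Euc n)
    (V := fun x : M ↦ Euc n →L[ℝ] TangentSpace (𝓡 n) x) u.2).hasMFDerivAt

theorem hasMFDerivAt_of_eq {f : FrameSpace n M → ℝ} {u : FrameSpace n M}
    (hf : MDifferentiableAt (frameModel n) 𝓘(ℝ, ℝ) f u) {u' : FrameSpace n M} (h : u' = u) :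
    HasMFDerivAt (frameModel n) 𝓘(ℝ, ℝ) f u' (frameDiff f u) := by
  subst h
  exact hf.hasMFDerivAt

theorem hasMFDerivAt_comp_frameSection {f : FrameSpace n M → ℝ} {u : FrameSpace n M}
    (hf : MDifferentiableAt (frameModel n) 𝓘(ℝ, ℝ) f u) :
    HasMFDerivAt (𝓡 n) 𝓘(ℝ, ℝ) (fun y ↦ f ⟨y, frameSection u y⟩) u.proj
      ((frameDiff f u).comp (sectionDeriv u)) := by
  refine HasMFDerivAt.comp u.proj (hasMFDerivAt_of_eq hf ?_) (hasMFDerivAt_frameSection u)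
  exact congrArg (TotalSpace.mk u.proj) (frameSection_self u)

theorem add_zero_smul_frame (u : FrameSpace n M) (B : Euc n →L[ℝ] TangentSpace (𝓡 n) u.proj) :
    (⟨u.proj, u.2 + (0 : ℝ) • B⟩ : FrameSpace n M) = u := by
  refine congrArg (TotalSpace.mk u.proj) ?_
  ext1 v
  change u.2 v + (0 : ℝ) • B v = u.2 v
  rw [zero_smul, add_zero]

theorem hasDerivAt_comp_vertical {f : FrameSpace n M → ℝ} {u : FrameSpace n M}
    (hf : MDifferentiableAt (frameModel n) 𝓘(ℝ, ℝ) f u)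
    (B : Euc n →L[ℝ] TangentSpace (𝓡 n) u.proj) :
    HasDerivAt (fun t : ℝ ↦ f ⟨u.proj, u.2 + t • B⟩) (frameDiff f u (verticalLift u B)) 0 := by
  have h := HasMFDerivAt.comp (0 : ℝ) (hasMFDerivAt_of_eq hf
    (u' := ⟨u.proj, u.2 + (0 : ℝ) • B⟩) (add_zero_smul_frame u B)) (hasMFDerivAt_vertical u B)
  have h2 : HasFDerivAt (𝕜 := ℝ) (fun t : ℝ ↦ f ⟨u.proj, u.2 + t • B⟩)
      ((frameDiff f u).comp ((verticalMap u).comp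
        (ContinuousLinearMap.toSpanSingleton ℝ (toCoord n u.proj u.proj ∘L B)))) (0 : ℝ) :=
    hasMFDerivAt_iff_hasFDerivAt.1 h
  rw [hasDerivAt_iff_hasFDerivAt]
  refine h2.congr_fderiv ?_
  ext
  change frameDiff f u (verticalMap u ((1 : ℝ) • (toCoord n u.proj u.proj ∘L B)))
    = (1 : ℝ) • frameDiff f u (verticalLift u B)
  rw [one_smul, one_smul]
  exact congrArg (frameDiff f u) (verticalLift_eq u B).symm

theorem horizontalDeriv_eq (k : Fin n) (f : FrameSpace n M → ℝ) (u : FrameSpace n M) :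
    horizontalDeriv cov k f u = frameDiff f u (sectionDeriv u (u.2 (stdVec k)))
      - frameDiff f u (verticalLift u
          (nablaFrame cov (frameSection u) u.proj (u.2 (stdVec k)))) :=
  (frameDiff f u).map_sub _ _

/-- Differentiating `A (u + t B) e_j = m_ij(t) (u + t B) e_i` at `t = 0`. -/
theorem sum_frameDiff_vertical (hA : SmoothEndField A) {u : FrameSpace n M}
    (hu : u.2.IsInvertible) (B : Euc n →L[ℝ] TangentSpace (𝓡 n) u.proj) (j : Fin n)
    (ℓ : TangentSpace (𝓡 n) u.proj →L[ℝ] ℝ) :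
    ℓ (A u.proj (B (stdVec j)))
      = ∑ i, (frameDiff (fun u' ↦ frameMatrix A u' i j) u (verticalLift u B) * ℓ (u.2 (stdVec i))
        + frameMatrix A u i j * ℓ (B (stdVec i))) := by
  have hm (i : Fin n) := hasDerivAt_comp_vertical
    ((contMDiffAt_frameMatrix hA hu i j).mdifferentiableAt (by simp)) B
  have haff (p : TangentSpace (𝓡 n) u.proj →L[ℝ] ℝ) (i : Fin n) :
      HasDerivAt (fun t : ℝ ↦ p ((u.2 + t • B) (stdVec i))) (p (B (stdVec i))) 0 := by
    have h : (fun t : ℝ ↦ p ((u.2 + t • B) (stdVec i)))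
        = fun t : ℝ ↦ p (u.2 (stdVec i)) + t * p (B (stdVec i)) := by
      funext t
      rw [add_apply, smul_apply, map_add, map_smul, smul_eq_mul]
    rw [h]
    simpa using ((hasDerivAt_id (0 : ℝ)).mul_const (p (B (stdVec i)))).const_add
      (p (u.2 (stdVec i)))
  -- The covector `ℓ` makes both sides scalar. The base point is fixed along the fibre, so the left
  -- side is affine in `t` and the right side needs only the product rule.
  have hR := HasDerivAt.fun_sum (u := Finset.univ) fun i _ ↦ (hm i).mul (haff ℓ i)
  have hL := haff (ℓ ∘L A u.proj) j
  have hev : (fun t : ℝ ↦ (ℓ ∘L A u.proj) ((u.2 + t • B) (stdVec j)))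
      =ᶠ[nhds 0] fun t ↦ ∑ i, frameMatrix A ⟨u.proj, u.2 + t • B⟩ i j
        * ℓ ((u.2 + t • B) (stdVec i)) := by
    have hc : ContinuousAt (fun t : ℝ ↦ (⟨u.proj, u.2 + t • B⟩ : FrameSpace n M)) 0 :=
      (hasMFDerivAt_vertical u B).continuousAt
    have hinv : ∀ᶠ u' : FrameSpace n M in nhds ⟨u.proj, u.2 + (0 : ℝ) • B⟩, u'.2.IsInvertible := by
      rw [add_zero_smul_frame]
      exact eventually_isInvertible hu
    filter_upwards [hc.eventually hinv] with t ht
    have h := congrArg ℓ (sum_frameMatrix_smul A (u := ⟨u.proj, u.2 + t • B⟩) ht j)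
    simp only [map_sum, map_smul, smul_eq_mul] at h
    exact h.symm
  have h := (hL.congr_of_eventuallyEq hev.symm).unique hR
  refine h.trans (Finset.sum_congr rfl fun i _ ↦ ?_)
  have h0 := add_zero_smul_frame u B
  have h1 : (u.2 + (0 : ℝ) • B) (stdVec i) = u.2 (stdVec i) := by
    change u.2 (stdVec i) + (0 : ℝ) • B (stdVec i) = _
    rw [zero_smul, add_zero]
  rw [h0, h1]

theorem nablaFrame_apply_stdVec (s : ∀ y : M, Euc n →L[ℝ] TangentSpace (𝓡 n) y) (x : M)
    (v : TangentSpace (𝓡 n) x) (j : Fin n) :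
    nablaFrame cov s x v (stdVec j) = cov (fun y ↦ s y (stdVec j)) x v := by
  simp [nablaFrame, stdVec, sum_apply]

theorem diffVF_congr {W W' : ∀ x : M, TangentSpace (𝓡 n) x} {x : M} (hW : DiffVF n W x)
    (h : ∀ᶠ y in nhds x, W' y = W y) : DiffVF n W' x :=
  hW.congr_of_eventuallyEq (h.mono fun y hy ↦ congrArg (TotalSpace.mk' (Euc n) y) hy)

theorem cov_congr {W W' : ∀ x : M, TangentSpace (𝓡 n) x} {x : M} (hW : DiffVF n W x)
    (h : ∀ᶠ y in nhds x, W' y = W y) : cov W' x = cov W x :=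
  cov.isCovariantDerivativeOnUniv.congr_of_eventuallyEq (diffVF_congr hW h) hW
    Filter.univ_mem h

theorem nablaFrame_frameSection (u : FrameSpace n M) (v : TangentSpace (𝓡 n) u.proj)
    (j : Fin n) : nablaFrame cov (frameSection u) u.proj v (stdVec j)
      = cov (frameExt u j) u.proj v := by
  rw [nablaFrame_apply_stdVec]
  refine DFunLike.congr_fun (cov_congr cov (diffVF_extend _) ?_) v
  filter_upwards [eventually_mem_baseSet (n := n) u.proj] with y hy
  exact frameSection_apply u hy _

/-- The Leibniz rule applied to `A s_j = A^i_j(s) s_i` along the local section `s`, the chain rule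
giving the derivative of the coefficients. -/
theorem cov_frameExt (hA : SmoothEndField A) {u : FrameSpace n M} (hu : u.2.IsInvertible)
    (v : TangentSpace (𝓡 n) u.proj) (j : Fin n) :
    cov (fun y ↦ A y (frameExt u j y)) u.proj v
      = ∑ i, (frameMatrix A u i j • cov (frameExt u i) u.proj v
        + frameDiff (fun u' ↦ frameMatrix A u' i j) u (sectionDeriv u v) • u.2 (stdVec i)) := by
  have hd (i : Fin n) := hasMFDerivAt_comp_frameSection
    ((contMDiffAt_frameMatrix hA hu i j).mdifferentiableAt (by simp))
  have hterm (i : Fin n) : DiffVF n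
      (fun y ↦ frameMatrix A ⟨y, frameSection u y⟩ i j • frameExt u i y) u.proj :=
    (hd i).mdifferentiableAt.smul_section (diffVF_extend _)
  have hev : ∀ᶠ y in nhds u.proj, A y (frameExt u j y)
      = ∑ i, frameMatrix A ⟨y, frameSection u y⟩ i j • frameExt u i y := by
    filter_upwards [eventually_mem_baseSet (n := n) u.proj] with y hy
    have h := sum_frameMatrix_smul A (u := ⟨y, frameSection u y⟩)
      (isInvertible_frameSection hu hy) j
    simp only [frameSection_apply u hy] at h
    exact h.symm
  rw [cov_congr cov (.sum_section fun i _ ↦ hterm i) hev, cov_sum cov _ fun i _ ↦ hterm i, sum_apply]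
  refine Finset.sum_congr rfl fun i _ ↦ ?_
  rw [cov_smul cov (diffVF_extend _) (hd i).mdifferentiableAt]
  have h1 : (⟨u.proj, frameSection u u.proj⟩ : FrameSpace n M) = u :=
    congrArg (TotalSpace.mk u.proj) (frameSection_self u)
  have h2 : frameExt u i u.proj = u.2 (stdVec i) := FiberBundle.extend_apply_self _ _
  have h3 : dfun (fun y ↦ frameMatrix A ⟨y, frameSection u y⟩ i j) u.proj v
      = frameDiff (fun u' ↦ frameMatrix A u' i j) u (sectionDeriv u v) :=
    DFunLike.congr_fun (hd i).mfderiv v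
  rw [h1]
  exact congrArg _ (congrArg₂ (· • ·) h3 h2)

/-- The horizontal derivative of the components of a `(1,1)`-tensor field in the frame is given by
the components of its covariant derivative. -/
theorem horizontalDeriv_frameMatrix (hA : SmoothEndField A) {u : FrameSpace n M}
    (hu : u.2.IsInvertible) (k i j : Fin n) :
    horizontalDeriv cov k (fun u' ↦ frameMatrix A u' i j) u
      = nablaComp cov A (frameBasis hu) k j i := by
  set b := frameBasis hu with hb
  have hδ (l : Fin n) : dualVec b i (u.2 (stdVec l)) = if i = l then 1 else 0 := by
    rw [← frameBasis_apply hu, dualVec_apply_basis]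
  have h1 := sum_frameDiff_vertical hA hu
    (nablaFrame cov (frameSection u) u.proj (u.2 (stdVec k))) j (dualVec b i)
  have h2 := congrArg (dualVec b i) (cov_frameExt cov hA hu (u.2 (stdVec k)) j)
  simp only [nablaFrame_frameSection] at h1
  simp only [map_sum, map_add, map_smul, smul_eq_mul] at h2
  simp only [hδ, Finset.sum_add_distrib, mul_ite, mul_one, mul_zero, Finset.sum_ite_eq,
    Finset.mem_univ, if_true] at h1 h2
  rw [horizontalDeriv_eq, nablaComp, nablaEnd, hb, frameBasis_apply, frameBasis_apply, ← hb,
    map_sub]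
  -- The sum of frame components times `∇ s_i` occurs in both identities and drops out; the section
  -- derivative minus the vertical one is the horizontal derivative.
  refine Eq.symm ((congrArg₂ (· - ·) h2 h1).trans ?_)
  ring

end FrameDerivative

/-! ### Smooth local frames and contractions. -/

section LocalFrames

variable {n : ℕ} {M : Type*} [TopologicalSpace M] [ChartedSpace (Euc n) M] [IsManifold (𝓡 n) ∞ M]

/-- The basis of `T_y M` given by the trivialization around `x`. -/
def coordBasis {x y : M} (hy : y ∈ (tangentTriv n x).baseSet) :
    Module.Basis (Fin n) ℝ (TangentSpace (𝓡 n) y) :=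
  (EuclideanSpace.basisFun (Fin n) ℝ).toBasis.map
    ((tangentTriv n x).continuousLinearEquivAt ℝ y hy).symm.toLinearEquiv

theorem coordBasis_apply {x y : M} (hy : y ∈ (tangentTriv n x).baseSet) (i : Fin n) :
    coordBasis hy i = ofCoord n x y (stdVec i) := by
  simp [coordBasis, stdVec, ofCoord, Trivialization.symmL_apply _ hy]

theorem dualVec_coordBasis {x y : M} (hy : y ∈ (tangentTriv n x).baseSet) (i : Fin n) :
    dualVec (coordBasis hy) i = (EuclideanSpace.proj i : Euc n →L[ℝ] ℝ) ∘L toCoord n x y := by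
  ext v
  simp [dualVec, coordBasis, toCoord, Trivialization.coe_linearMapAt_of_mem _ hy]

theorem comp_coordBasis {x y : M} (hy : y ∈ (tangentTriv n x).baseSet) (K : BiContra (n := n) y)
    (i j : Fin n) : K.comp (coordBasis hy) i j = biCoord x K (EuclideanSpace.proj j) i := by
  rw [BiContra.comp, dualVec_coordBasis, dualVec_coordBasis]
  rfl

theorem contMDiffOn_ofCoord (x : M) (v : Euc n) :
    ContMDiffOn (𝓡 n) ((𝓡 n).prod 𝓘(ℝ, Euc n)) ∞
      (fun y ↦ TotalSpace.mk' (Euc n) (E := fun x : M ↦ TangentSpace (𝓡 n) x) y (ofCoord n x y v))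
      (tangentTriv n x).baseSet := by
  rw [Trivialization.contMDiffOn_section_baseSet_iff]
  refine (contMDiffOn_const (c := v)).congr fun y hy ↦ ?_
  have h := toCoord_ofCoord hy v
  rwa [toCoord, Trivialization.continuousLinearMapAt_apply,
    Trivialization.coe_linearMapAt_of_mem _ hy] at h

theorem exists_smoothVectorField_eq_ofCoord [T2Space M] (x : M) (v : Euc n) :
    ∃ W : ∀ y : M, TangentSpace (𝓡 n) y, SmoothVectorField W ∧
      ∀ᶠ y in nhds x, W y = ofCoord n x y v := by
  -- A bump function supported in the trivialization domain makes the local field global without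
  -- changing it near `x`.
  obtain ⟨f, -, hf⟩ := (SmoothBumpFunction.nhds_basis_tsupport (I := 𝓡 n) x).mem_iff.1
    ((tangentTriv n x).open_baseSet.mem_nhds (mem_baseSet_self x))
  refine ⟨(f : M → ℝ) • fun y ↦ ofCoord n x y v,
    ContMDiffOn.smul_section_of_tsupport f.contMDiff.contMDiffOn (tangentTriv n x).open_baseSet hf
      (contMDiffOn_ofCoord x v), ?_⟩
  filter_upwards [f.eventuallyEq_one] with y hy
  change f y • ofCoord n x y v = _
  rw [hy, Pi.one_apply, one_smul]

theorem SmoothEndField.apply {A : ∀ x : M, TangentSpace (𝓡 n) x →L[ℝ] TangentSpace (𝓡 n) x}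
    (hA : SmoothEndField A) {W : ∀ x : M, TangentSpace (𝓡 n) x} (hW : SmoothVectorField W) :
    SmoothVectorField fun x ↦ A x (W x) :=
  fun x ↦ ContMDiffAt.clm_bundle_apply (F₁ := Euc n) (F₂ := Euc n) (hA x) (hW x)

theorem SmoothBiContraField.sub {K L : ∀ x : M, BiContra (n := n) x} (hK : SmoothBiContraField K)
    (hL : SmoothBiContraField L) : SmoothBiContraField fun x ↦ K x - L x := by
  rw [smoothBiContraField_iff] at hK hL ⊢
  intro x
  refine ((hK x).sub (hL x)).congr_of_eventuallyEq (.of_forall fun y ↦ ?_)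
  ext1 r
  exact (toCoord n x y).map_sub _ _

theorem contMDiffAt_contraction {K : ∀ x : M, BiContra (n := n) x} (hK : SmoothBiContraField K)
    {T : Fin n → Fin n → ∀ x : M, TangentSpace (𝓡 n) x}
    (hT : ∀ i j, SmoothVectorField (T i j)) (x : M) :
    ContMDiffAt (𝓡 n) ((𝓡 n).prod 𝓘(ℝ, Euc n)) ∞
      (fun y ↦ TotalSpace.mk' (Euc n) (E := fun x : M ↦ TangentSpace (𝓡 n) x) y
        (∑ i, ∑ j, biCoord x (K y) (EuclideanSpace.proj j) i • T i j y)) x := by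
  refine ContMDiffAt.sum_section fun i _ ↦ ContMDiffAt.sum_section fun j _ ↦
    ContMDiffAt.smul_section ?_ (hT i j x)
  have h := ((smoothBiContraField_iff.1 hK) x).clm_apply
    (contMDiffAt_const (c := (EuclideanSpace.proj j : Euc n →L[ℝ] ℝ)))
  exact ContMDiffAt.comp (I' := 𝓘(ℝ, Euc n)) (g := (EuclideanSpace.proj i : Euc n →L[ℝ] ℝ)) x
    (EuclideanSpace.proj i : Euc n →L[ℝ] ℝ).contMDiff.contMDiffAt h

end LocalFrames

/-! ### The drift vector: independence of the basis and smoothness. -/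

section CovariantDerivative

variable {n : ℕ} {M : Type*} [TopologicalSpace M] [ChartedSpace (Euc n) M] [IsManifold (𝓡 n) ∞ M]
  {cov : CovariantDerivative (𝓡 n) (Euc n) (fun x : M ↦ TangentSpace (𝓡 n) x)}
  {A : ∀ x : M, TangentSpace (𝓡 n) x →L[ℝ] TangentSpace (𝓡 n) x}

theorem smoothVectorField_cov (hcov : cov.ContMDiffCovariantDerivative ∞)
    {V W : ∀ x : M, TangentSpace (𝓡 n) x} (hV : SmoothVectorField V) (hW : SmoothVectorField W) :
    SmoothVectorField fun x ↦ cov W x (V x) := by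
  have h := hcov.contMDiff.contMDiff (σ := W) (ContMDiff.contMDiffOn hW)
  intro x
  exact ContMDiffAt.clm_bundle_apply (F₁ := Euc n) (F₂ := Euc n)
    (h.contMDiffAt Filter.univ_mem) (hV x)

theorem SmoothVectorField.diffVF {W : ∀ x : M, TangentSpace (𝓡 n) x} (hW : SmoothVectorField W)
    (x : M) : DiffVF n W x := (hW x).mdifferentiableAt (by simp)

theorem smoothVectorField_nablaEnd (hcov : cov.ContMDiffCovariantDerivative ∞)
    (hA : SmoothEndField A) {V W : ∀ x : M, TangentSpace (𝓡 n) x} (hV : SmoothVectorField V)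
    (hW : SmoothVectorField W) : SmoothVectorField fun x ↦ nablaEnd cov A x (V x) (W x) := by
  have h : (fun x ↦ nablaEnd cov A x (V x) (W x))
      = (fun x ↦ cov (fun y ↦ A y (W y)) x (V x)) - fun x ↦ A x (cov W x (V x)) :=
    funext fun x ↦ nablaEnd_eq cov hA (hW.diffVF x) (V x)
  rw [h]
  exact ContMDiff.sub_section (smoothVectorField_cov hcov hV (hA.apply hW))
    (hA.apply (smoothVectorField_cov hcov hV hW))

variable (cov) in
/-- The covariant derivative of a `(1,1)`-tensor field at a point, as a bilinear map. -/
def nablaBilin (hA : SmoothEndField A) (x : M) :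
    TangentSpace (𝓡 n) x →ₗ[ℝ] TangentSpace (𝓡 n) x →ₗ[ℝ] TangentSpace (𝓡 n) x :=
  LinearMap.mk₂ ℝ (nablaEnd cov A x)
    (fun v w z ↦ (nablaHom cov hA x z).map_add v w)
    (fun c v z ↦ (nablaHom cov hA x z).map_smul c v)
    (fun v w z ↦ DFunLike.congr_fun ((nablaHom cov hA x).map_add w z) v)
    (fun c v w ↦ DFunLike.congr_fun ((nablaHom cov hA x).map_smul c w) v)

variable [RiemannianBundle (fun x : M ↦ TangentSpace (𝓡 n) x)]
  {γ σ : ∀ x : M, TangentSpace (𝓡 n) x →L[ℝ] TangentSpace (𝓡 n) x}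

/-- Only the indices contracted with `g⁻¹` and `L - J` are kept, so each term becomes a 2-tensor
contracted with a vector-valued map of two vectors. -/
theorem driftVector_eq (x : M) (b : Module.Basis (Fin n) ℝ (TangentSpace (𝓡 n) x)) :
    driftVector γ σ cov x b = (-(1 / 2) : ℝ) •
      (∑ i, ∑ j, (inverseMetric x).comp b i j • inverseField γ x
          (nablaEnd cov σ x (inverseField γ x (σ x (b i))) (b j))
        + ∑ i, ∑ j, (tensorL γ σ x - tensorJ γ σ x).comp b i j •
          nablaEnd cov (inverseField γ) x (b i) (b j)) := by
  conv_rhs => rw [← sum_dualVec_smul b (_ • _)]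
  refine Finset.sum_congr rfl fun χ _ ↦ congrArg (· • b χ) ?_
  have h1 (v : TangentSpace (𝓡 n) x) : dualVec b χ (inverseField γ x v)
      = ∑ δ, endComp (inverseField γ x) b χ δ * dualVec b δ v := by
    conv_lhs => rw [← sum_dualVec_smul b v]
    simp [endComp, mul_comm]
  have h2 (v w : TangentSpace (𝓡 n) x) : nablaEnd cov σ x v w
      = ∑ β, dualVec b β v • nablaEnd cov σ x (b β) w := by
    let N : TangentSpace (𝓡 n) x →L[ℝ] TangentSpace (𝓡 n) x :=
      cov (fun y ↦ σ y (FiberBundle.extend (Euc n) w y)) x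
        - σ x ∘L cov (FiberBundle.extend (Euc n) w) x
    change N v = ∑ β, dualVec b β v • N (b β)
    conv_lhs => rw [← sum_dualVec_smul b v]
    simp
  rw [map_smul, map_add, smul_eq_mul]
  simp only [map_sum, map_smul, smul_eq_mul, h1]
  have h3 (i j : Fin n) : (tensorL γ σ x - tensorJ γ σ x).comp b i j
      = (tensorL γ σ x).comp b i j - (tensorJ γ σ x).comp b i j :=
    (dualVec b i).map_sub _ _
  simp only [h3]
  have h4 (i j δ : Fin n) : dualVec b δ (nablaEnd cov σ x (inverseField γ x (σ x (b i))) (b j))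
      = ∑ β, endComp (inverseField γ x ∘L σ x) b β i * nablaComp cov σ b β j δ := by
    rw [h2, map_sum]
    exact Finset.sum_congr rfl fun β _ ↦ (dualVec b δ).map_smul _ _
  simp only [h4, nablaComp, Finset.mul_sum]
  simp only [sub_eq_add_neg, mul_add, Finset.mul_sum, ← Finset.sum_neg_distrib]
  refine congrArg₂ (· + ·) ?_ ?_
  · refine Finset.sum_congr rfl fun i _ ↦ Finset.sum_congr rfl fun j _ ↦ ?_
    rw [Finset.sum_comm]
    exact Finset.sum_congr rfl fun δ _ ↦ Finset.sum_congr rfl fun β _ ↦ by ring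
  · exact Finset.sum_congr rfl fun i _ ↦ Finset.sum_congr rfl fun j _ ↦ by ring

theorem driftVector_eq_driftVector (hσ : SmoothEndField σ)
    (hinv : SmoothEndField (inverseField γ)) (x : M)
    (b c : Module.Basis (Fin n) ℝ (TangentSpace (𝓡 n) x)) :
    driftVector γ σ cov x b = driftVector γ σ cov x c := by
  rw [driftVector_eq, driftVector_eq]
  refine congrArg _ (congrArg₂ (· + ·) ?_ ?_)
  · exact sum_comp_smul_eq b c (inverseMetric x)
      (((nablaBilin cov hσ x).comp (inverseField γ x ∘L σ x).toLinearMap).compr₂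
        (inverseField γ x).toLinearMap)
  · exact sum_comp_smul_eq b c (tensorL γ σ x - tensorJ γ σ x) (nablaBilin cov hinv x)

variable [T2Space M]
  [IsContMDiffRiemannianBundle (𝓡 n) ∞ (Euc n) (fun x : M ↦ TangentSpace (𝓡 n) x)]

/-- Since any basis computes `Y`, near `x` the basis of the trivialization may be used; it agrees
there with globally smooth fields. -/
theorem smoothVectorField_of_eq_driftVector (hcov : cov.ContMDiffCovariantDerivative ∞)
    (hσ : SmoothEndField σ) (hinv : SmoothEndField (inverseField γ))
    (hJ : SmoothBiContraField (tensorJ γ σ)) (hL : SmoothBiContraField (tensorL γ σ))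
    {Y : ∀ x : M, TangentSpace (𝓡 n) x}
    (hY : ∀ x b, Y x = driftVector γ σ cov x b) : SmoothVectorField Y := by
  intro x
  choose W hW hWx using fun i ↦ exists_smoothVectorField_eq_ofCoord (n := n) x (stdVec i)
  have h1 := contMDiffAt_contraction (smoothBiContraField_inverseMetric (n := n) (M := M))
    (T := fun i j y ↦ inverseField γ y
      (nablaEnd cov σ y (inverseField γ y (σ y (W i y))) (W j y)))
    (fun i j ↦ hinv.apply (smoothVectorField_nablaEnd hcov hσ (hinv.apply (hσ.apply (hW i)))
      (hW j))) x
  have h2 := contMDiffAt_contraction (hL.sub hJ)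
    (T := fun i j y ↦ nablaEnd cov (inverseField γ) y (W i y) (W j y))
    (fun i j ↦ smoothVectorField_nablaEnd hcov hinv (hW i) (hW j)) x
  refine (ContMDiffAt.const_smul_section (a := (-(1 / 2) : ℝ))
    (h1.add_section h2)).congr_of_eventuallyEq ?_
  filter_upwards [eventually_mem_baseSet (n := n) x, Filter.eventually_all.2 hWx] with y hy hWy
  refine congrArg (TotalSpace.mk' (Euc n) y) ?_
  rw [hY y (coordBasis hy), driftVector_eq]
  simp only [comp_coordBasis, coordBasis_apply, ← hWy]
  rfl

end CovariantDerivative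

/-! ### Exponentials of operators and of their matrices. -/

section MatrixExponential

variable {E : Type*} [NormedAddCommGroup E] [InnerProductSpace ℝ E] [FiniteDimensional ℝ E] {n : ℕ}

attribute [local instance] Matrix.linftyOpNormedRing Matrix.linftyOpNormedAlgebra in
/-- The matrix of the exponential of an operator is the exponential of its matrix. -/
theorem toMatrixAlgEquiv_exp (b : Module.Basis (Fin n) ℝ E) (A : E →L[ℝ] E) :
    LinearMap.toMatrixAlgEquiv b (NormedSpace.exp A).toLinearMap
      = NormedSpace.exp (LinearMap.toMatrixAlgEquiv b A.toLinearMap) := by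
  have : CompleteSpace E := FiniteDimensional.complete ℝ E
  let f : (E →L[ℝ] E) →+* Matrix (Fin n) (Fin n) ℝ :=
    (LinearMap.toMatrixAlgEquiv b : (E →ₗ[ℝ] E) →+* Matrix (Fin n) (Fin n) ℝ).comp
      ContinuousLinearMap.toLinearMapRingHom
  have hf : Continuous f := LinearMap.continuous_of_finiteDimensional
    ((LinearMap.toMatrixAlgEquiv b).toLinearMap ∘ₗ ContinuousLinearMap.coeLM ℝ)
  let : NormedAlgebra ℚ (E →L[ℝ] E) := NormedAlgebra.restrictScalars ℚ ℝ _
  exact NormedSpace.map_exp f hf A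

end MatrixExponential

/-! ### Components in an orthonormal frame. -/

section Frames

variable {n : ℕ} {M : Type*} [TopologicalSpace M] [ChartedSpace (Euc n) M] [IsManifold (𝓡 n) ∞ M]
  {γ σ : ∀ x : M, TangentSpace (𝓡 n) x →L[ℝ] TangentSpace (𝓡 n) x}

theorem frameMatrix_inv {u : FrameSpace n M} (hu : u.2.IsInvertible)
    (hγ : (γ u.proj).IsInvertible) :
    (frameMatrix γ u)⁻¹ = frameMatrix (inverseField γ) u := by
  refine Matrix.inv_eq_left_inv (Matrix.ext fun i j ↦ ?_)
  simp only [Matrix.mul_apply, frameMatrix_eq_endComp _ hu]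
  rw [← endComp_comp, inverseField, inverse_comp_self hγ, Matrix.one_apply,
    ← dualVec_apply_basis (frameBasis hu)]
  rfl

theorem horizontalDeriv_frameMatrix_inv
    (cov : CovariantDerivative (𝓡 n) (Euc n) (fun x : M ↦ TangentSpace (𝓡 n) x))
    (hγ : ∀ x, (γ x).IsInvertible) (hinv : SmoothEndField (inverseField γ))
    {u : FrameSpace n M} (hu : u.2.IsInvertible) (k i j : Fin n) :
    horizontalDeriv cov k (fun u' ↦ (frameMatrix γ u')⁻¹ i j) u
      = nablaComp cov (inverseField γ) (frameBasis hu) k j i := by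
  rw [← horizontalDeriv_frameMatrix cov hinv hu]
  have h : (fun u' ↦ (frameMatrix γ u')⁻¹ i j)
      =ᶠ[nhds u] fun u' ↦ frameMatrix (inverseField γ) u' i j := by
    filter_upwards [eventually_isInvertible hu] with u' hu'
    rw [frameMatrix_inv hu' (hγ u'.proj)]
  exact congrArg (fun L : FrameVec n →L[ℝ] ℝ ↦ L (horizontalField cov (stdVec k) u))
    h.mfderiv_eq

variable [RiemannianBundle (fun x : M ↦ TangentSpace (𝓡 n) x)]

theorem isInvertible_of_mem_orthonormalFrames {u : FrameSpace n M}
    (hu : u ∈ orthonormalFrames n M) : u.2.IsInvertible := by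
  have hinj : Function.Injective u.2.toLinearMap := by
    refine (injective_iff_map_eq_zero _).2 fun v hv ↦ ?_
    have h := hu v v
    rw [show u.2 v = 0 from hv, inner_zero_left] at h
    exact inner_self_eq_zero.1 h.symm
  refine ⟨(LinearEquiv.ofInjectiveOfFinrankEq u.2.toLinearMap hinj rfl).toContinuousLinearEquiv, ?_⟩
  ext1 v
  rfl

theorem inner_frameBasis {u : FrameSpace n M} (hu : u ∈ orthonormalFrames n M)
    (hi : u.2.IsInvertible) (i j : Fin n) :
    inner ℝ (frameBasis hi i) (frameBasis hi j) = if i = j then (1 : ℝ) else 0 := by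
  rw [frameBasis_apply, frameBasis_apply, hu]
  simp [stdVec, EuclideanSpace.inner_single_left]

/-- The orthonormality of `u` enters here: the dual covectors are the inner products with the frame
vectors. -/
theorem comp_inverseMetric {u : FrameSpace n M} (hu : u ∈ orthonormalFrames n M)
    (hi : u.2.IsInvertible) (i j : Fin n) :
    (inverseMetric u.proj).comp (frameBasis hi) i j = if i = j then 1 else 0 := by
  have h : dualVec (frameBasis hi) j = innerSL ℝ (frameBasis hi j) := by
    ext v
    conv_rhs => rw [← sum_dualVec_smul (frameBasis hi) v]
    simp only [innerSL_apply_apply, inner_sum, inner_smul_right, inner_frameBasis hu hi]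
    simp
  rw [BiContra.comp, h, inverseMetric_innerSL, dualVec_apply_basis]

theorem frameSigma_eq {u : FrameSpace n M} (hu : u ∈ orthonormalFrames n M)
    (hi : u.2.IsInvertible) (i j : Fin n) :
    frameSigma (frameMatrix σ) u i j = (tensorSigma σ u.proj).comp (frameBasis hi) i j := by
  rw [tensorSigma, comp_push]
  simp only [comp_inverseMetric hu hi, frameSigma, frameMatrix_eq_endComp _ hi]
  simp

theorem exp_frameMatrix {u : FrameSpace n M} (hi : u.2.IsInvertible) (y : ℝ) (i j : Fin n) :
    NormedSpace.exp (-y • frameMatrix γ u) i j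
      = endComp (NormedSpace.exp (-y • γ u.proj)) (frameBasis hi) i j := by
  have h1 : -y • frameMatrix γ u = LinearMap.toMatrixAlgEquiv (frameBasis hi)
      (-y • γ u.proj).toLinearMap := by
    ext i j
    rw [LinearMap.toMatrixAlgEquiv_apply]
    change -y * frameMatrix γ u i j = dualVec (frameBasis hi) i (-y • γ u.proj (frameBasis hi j))
    rw [map_smul, frameMatrix_eq_endComp _ hi]
    rfl
  rw [h1, ← toMatrixAlgEquiv_exp, LinearMap.toMatrixAlgEquiv_apply]
  rfl

theorem frameJ_eq {u : FrameSpace n M} (hu : u ∈ orthonormalFrames n M)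
    (hi : u.2.IsInvertible) (hγ : ExpDecay (γ u.proj)) (i j : Fin n) :
    frameJ (frameMatrix γ) (frameMatrix σ) u i j
      = (tensorJ γ σ u.proj).comp (frameBasis hi) i j := by
  set b := frameBasis hi with hb
  let e (y : ℝ) := NormedSpace.exp (-y • γ u.proj)
  have hint (k l : Fin n) :
      IntegrableOn (fun y ↦ endComp (e y) b i k * endComp (e y) b j l) (Set.Ioi 0) := by
    -- For the rank-one tensor `b_k ⊗ b_l` the pairing is exactly the product of two entries of the
    -- exponential.
    refine (hγ.integrableOn_expPairing ((ContinuousLinearMap.apply ℝ ℝ (b l)).smulRight (b k))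
      (dualVec b i) (dualVec b j)).congr_fun (fun y _ ↦ ?_) measurableSet_Ioi
    change dualVec b i (e y (dualVec b j (e y (b l)) • b k)) = _
    rw [map_smul, map_smul, smul_eq_mul, mul_comm]
    rfl
  have hJ : (tensorJ γ σ u.proj).comp b i j = ∫ y in Set.Ioi (0 : ℝ),
      ∑ k, ∑ l, (endComp (e y) b i k * endComp (e y) b j l) * (tensorSigma σ u.proj).comp b k l := by
    refine (tensorJ_apply hγ (dualVec b i) (dualVec b j)).trans ?_
    refine setIntegral_congr_fun measurableSet_Ioi fun y _ ↦ ?_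
    refine (comp_push (e y) (e y) (tensorSigma σ u.proj) b i j).trans ?_
    exact Finset.sum_congr rfl fun k _ ↦ Finset.sum_congr rfl fun l _ ↦ by ring
  rw [hJ, integral_finsetSum _ fun k _ ↦ integrable_finsetSum _ fun l _ ↦ (hint k l).mul_const _]
  simp only [integral_finsetSum _ fun l _ ↦ (hint _ l).mul_const _, integral_mul_const]
  simp only [frameJ, frameG, frameSigma_eq hu hi, exp_frameMatrix hi]
  rfl

end Frames

/-! ### Comparison of the two drift formulas. -/

section Drift

/-- Pure reindexing: the Kronecker delta, standing for the inverse metric, collapses one sum, and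
the output index is moved outermost. -/
theorem drift_sum_eq {n : ℕ} {F : Type*} [AddCommGroup F] [Module ℝ F]
    (P Q K : Fin n → Fin n → ℝ) (N N' : Fin n → Fin n → Fin n → ℝ) (h : Fin n → F) :
    -((1 / 2 : ℝ) • ∑ α, ∑ η, ∑ μ, ∑ ξ, ∑ ν, (P η μ * Q μ α * P ξ ν * N η α ν) • h ξ)
      - (1 / 2 : ℝ) • ∑ η, ∑ ν, ∑ ξ, (K η ν * N' η ν ξ) • h ξ
      = ∑ χ, (-(1 / 2) * (∑ ν, ∑ ρ, ∑ β, ∑ δ,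
            (if ν = ρ then 1 else 0) * (∑ μ, P β μ * Q μ ν) * P χ δ * N β ρ δ)
          - (1 / 2) * (∑ β, ∑ ρ, K β ρ * N' β ρ χ)) • h χ := by
  have h1 : ∑ α, ∑ η, ∑ μ, ∑ ξ, ∑ ν, (P η μ * Q μ α * P ξ ν * N η α ν) • h ξ
      = ∑ χ, (∑ ν, ∑ ρ, ∑ β, ∑ δ,
        (if ν = ρ then 1 else 0) * (∑ μ, P β μ * Q μ ν) * P χ δ * N β ρ δ) • h χ := by
    have h3 (χ : Fin n) : (∑ ν, ∑ ρ, ∑ β, ∑ δ,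
        (if ν = ρ then 1 else 0) * (∑ μ, P β μ * Q μ ν) * P χ δ * N β ρ δ) • h χ
        = ∑ α, ∑ η, ∑ μ, ∑ ν, (P η μ * Q μ α * P χ ν * N η α ν) • h χ := by
      simp only [← Finset.sum_smul]
      refine congrArg (· • h χ) (Finset.sum_congr rfl fun α _ ↦ ?_)
      rw [Finset.sum_eq_single α (fun ρ _ hρ ↦ by simp [hρ.symm]) (by simp)]
      refine Finset.sum_congr rfl fun η _ ↦ ?_
      rw [Finset.sum_comm]
      simp only [if_true, one_mul, Finset.sum_mul]
    simp only [h3]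
    symm
    rw [Finset.sum_comm]
    refine Finset.sum_congr rfl fun α _ ↦ ?_
    rw [Finset.sum_comm]
    refine Finset.sum_congr rfl fun η _ ↦ ?_
    rw [Finset.sum_comm]
  have h2 : ∑ η, ∑ ν, ∑ ξ, (K η ν * N' η ν ξ) • h ξ
      = ∑ χ, (∑ β, ∑ ρ, K β ρ * N' β ρ χ) • h χ := by
    simp only [Finset.sum_smul]
    symm
    rw [Finset.sum_comm]
    refine Finset.sum_congr rfl fun η _ ↦ ?_
    rw [Finset.sum_comm]
  rw [h1, h2, Finset.smul_sum, Finset.smul_sum, ← Finset.sum_neg_distrib, ← Finset.sum_sub_distrib]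
  refine Finset.sum_congr rfl fun χ _ ↦ ?_
  module

variable {n : ℕ} {M : Type*} [TopologicalSpace M] [ChartedSpace (Euc n) M] [IsManifold (𝓡 n) ∞ M]
  [RiemannianBundle (fun x : M ↦ TangentSpace (𝓡 n) x)]
  {γ σ : ∀ x : M, TangentSpace (𝓡 n) x →L[ℝ] TangentSpace (𝓡 n) x}

/-- The noise-induced drift is the horizontal lift of the drift vector field. -/
theorem noiseInducedDrift_eq_horizontalLift
    (cov : CovariantDerivative (𝓡 n) (Euc n) (fun x : M ↦ TangentSpace (𝓡 n) x))
    (hdec : ∀ x, ExpDecay (γ x)) (hσ : SmoothEndField σ)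
    (hinv : SmoothEndField (inverseField γ)) {u : FrameSpace n M}
    (hu : u ∈ orthonormalFrames n M) (hi : u.2.IsInvertible) :
    noiseInducedDrift cov (frameMatrix γ) (frameMatrix σ) u
      = horizontalLift cov u (driftVector γ σ cov u.proj (frameBasis hi)) := by
  set b := frameBasis hi with hb
  -- The coefficient of the second term is a component of `L - J`, by `L = γ⁻¹ J γᵀ`.
  have hK (η ν : Fin n) : (∑ μ, ∑ χ, (frameMatrix γ u)⁻¹ η μ
      * frameJ (frameMatrix γ) (frameMatrix σ) u μ χ * frameMatrix γ u ν χ)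
        - frameJ (frameMatrix γ) (frameMatrix σ) u η ν
      = (tensorL γ σ u.proj).comp b η ν - (tensorJ γ σ u.proj).comp b η ν := by
    rw [tensorL_eq_push (hdec u.proj), comp_push, frameMatrix_inv hi (hdec u.proj).isInvertible]
    simp only [frameJ_eq hu hi (hdec u.proj), frameMatrix_eq_endComp _ hi]
    rfl
  have hL : (horizontalLift cov u (driftVector γ σ cov u.proj b) : FrameVec n)
      = ∑ χ, (-(1 / 2) * (∑ ν, ∑ ρ, ∑ β, ∑ δ, (if ν = ρ then 1 else 0)
          * (∑ μ, endComp (inverseField γ u.proj) b β μ * endComp (σ u.proj) b μ ν)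
            * endComp (inverseField γ u.proj) b χ δ * nablaComp cov σ b β ρ δ)
        - (1 / 2) * (∑ β, ∑ ρ,
            ((tensorL γ σ u.proj).comp b β ρ - (tensorJ γ σ u.proj).comp b β ρ)
              * nablaComp cov (inverseField γ) b β ρ χ)) • horizontalLiftLinear cov u (b χ) := by
    change horizontalLiftLinear cov u (driftVector γ σ cov u.proj b) = _
    rw [driftVector, map_sum]
    refine Finset.sum_congr rfl fun χ _ ↦ ?_
    rw [(horizontalLiftLinear cov u).map_smul]
    simp only [hb, comp_inverseMetric hu hi, endComp_comp]
  have hH (ξ : Fin n) : (horizontalField cov (stdVec ξ) u : FrameVec n)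
      = horizontalLiftLinear cov u (b ξ) :=
    congrArg (horizontalLiftLinear cov u) (frameBasis_apply hi ξ).symm
  have hN (η a ν : Fin n) : horizontalDeriv cov η (fun u' ↦ frameMatrix σ u' ν a) u
      = nablaComp cov σ b η a ν := horizontalDeriv_frameMatrix cov hσ hi η ν a
  have hN' (η ν ξ : Fin n) : horizontalDeriv cov η (fun u' ↦ (frameMatrix γ u')⁻¹ ξ ν) u
      = nablaComp cov (inverseField γ) b η ν ξ :=
    horizontalDeriv_frameMatrix_inv cov (fun x ↦ (hdec x).isInvertible) hinv hi η ξ ν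
  have hP (i j : Fin n) : (frameMatrix γ u)⁻¹ i j = endComp (inverseField γ u.proj) b i j := by
    rw [frameMatrix_inv hi (hdec u.proj).isInvertible, frameMatrix_eq_endComp _ hi]
  have hQ (i j : Fin n) : frameMatrix σ u i j = endComp (σ u.proj) b i j :=
    frameMatrix_eq_endComp _ hi i j
  refine Eq.trans ?_ ((drift_sum_eq (F := FrameVec n) (endComp (inverseField γ u.proj) b)
    (endComp (σ u.proj) b)
    (fun β ρ ↦ (tensorL γ σ u.proj).comp b β ρ - (tensorJ γ σ u.proj).comp b β ρ)
    (nablaComp cov σ b) (nablaComp cov (inverseField γ) b)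
    (fun χ ↦ horizontalLiftLinear cov u (b χ))).trans hL.symm)
  refine congrArg₂ (fun v w : FrameVec n ↦ -((1 / 2 : ℝ) • v) - (1 / 2 : ℝ) • w) ?_ ?_
  · refine Finset.sum_congr rfl fun α _ ↦ Finset.sum_congr rfl fun η _ ↦
      Finset.sum_congr rfl fun μ _ ↦ Finset.sum_congr rfl fun ξ _ ↦
      Finset.sum_congr rfl fun ν _ ↦ congrArg₂ (fun (c : ℝ) (v : FrameVec n) ↦ c • v) ?_ (hH ξ)
    rw [hP, hP, hQ, hN]
  · refine Finset.sum_congr rfl fun η _ ↦ Finset.sum_congr rfl fun ν _ ↦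
      Finset.sum_congr rfl fun ξ _ ↦
      congrArg₂ (fun (c : ℝ) (v : FrameVec n) ↦ c • v) ?_ (hH ξ)
    rw [hK, hN']

end Drift

end NoiseDrift

end

theorem mainTheorem10 (n : ℕ) (M : Type*) [TopologicalSpace M] [T2Space M] [CompactSpace M]
    [ConnectedSpace M] [ChartedSpace (NoiseDrift.Euc n) M] [IsManifold (𝓡 n) ∞ M]
    [RiemannianBundle (fun x : M ↦ TangentSpace (𝓡 n) x)]
    [IsContMDiffRiemannianBundle (𝓡 n) ∞ (NoiseDrift.Euc n)
      (fun x : M ↦ TangentSpace (𝓡 n) x)]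
    (cov : CovariantDerivative (𝓡 n) (NoiseDrift.Euc n) (fun x : M ↦ TangentSpace (𝓡 n) x))
    (hcov : NoiseDrift.IsLeviCivita cov)
    (γ σ : ∀ x : M, TangentSpace (𝓡 n) x →L[ℝ] TangentSpace (𝓡 n) x)
    (hγ : NoiseDrift.SmoothEndField γ) (hσ : NoiseDrift.SmoothEndField σ)
    (γ₁ : ℝ) (hγ₁ : 0 < γ₁)
    (hdrag : ∀ (x : M) (c : ℝ),
      Module.End.HasEigenvalue (NoiseDrift.symmetricPart γ x) c → γ₁ ≤ c) :
    (∀ (x : M) (b : Module.Basis (Fin n) ℝ (TangentSpace (𝓡 n) x)) (μ ν : Fin n),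
      IntegrableOn (fun y ↦ (NoiseDrift.integrandJ γ σ x y).comp b μ ν) (Set.Ioi 0) ∧
      IntegrableOn (fun y ↦ (NoiseDrift.integrandL γ σ x y).comp b μ ν) (Set.Ioi 0)) ∧
    NoiseDrift.SmoothBiContraField (NoiseDrift.tensorSigma σ) ∧
    NoiseDrift.SmoothBiContraField (NoiseDrift.tensorJ γ σ) ∧
    NoiseDrift.SmoothBiContraField (NoiseDrift.tensorL γ σ) ∧
    ∃ Y : ∀ x : M, TangentSpace (𝓡 n) x,
      NoiseDrift.SmoothVectorField Y ∧
      (∀ (x : M) (b : Module.Basis (Fin n) ℝ (TangentSpace (𝓡 n) x)),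
        Y x = NoiseDrift.driftVector γ σ cov x b) ∧
      ∀ u ∈ NoiseDrift.orthonormalFrames n M,
        NoiseDrift.noiseInducedDrift cov (NoiseDrift.frameMatrix γ) (NoiseDrift.frameMatrix σ) u =
          NoiseDrift.horizontalLift cov u (Y u.proj) := by
  have hdec (x : M) : NoiseDrift.ExpDecay (γ x) :=
    NoiseDrift.expDecay_of_symmetricPart hγ₁ (hdrag x)
  have hJ := NoiseDrift.smoothBiContraField_tensorJ hγ hdec
    (NoiseDrift.smoothBiContraField_tensorSigma hσ)
  have hL := NoiseDrift.smoothBiContraField_tensorL hγ hdec hσ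
  have hinv : NoiseDrift.SmoothEndField (NoiseDrift.inverseField γ) :=
    hγ.inverse fun x ↦ (hdec x).isInvertible
  -- `Y(x)` is defined through the basis of the trivialization at `x`; any other would do, and the
  -- basis `u e_i` is substituted for the comparison with the frame bundle.
  have hY (x : M) (b : Module.Basis (Fin n) ℝ (TangentSpace (𝓡 n) x)) :
      NoiseDrift.driftVector γ σ cov x (NoiseDrift.coordBasis (NoiseDrift.mem_baseSet_self x))
        = NoiseDrift.driftVector γ σ cov x b :=
    NoiseDrift.driftVector_eq_driftVector hσ hinv x _ b
  refine ⟨fun x b μ ν ↦ ⟨NoiseDrift.integrableOn_integrandJ (hdec x) _ _,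
      NoiseDrift.integrableOn_integrandL (hdec x) _ _⟩,
    NoiseDrift.smoothBiContraField_tensorSigma hσ, hJ, hL, _,
    NoiseDrift.smoothVectorField_of_eq_driftVector hcov.smooth hσ hinv hJ hL hY, hY,
    fun u hu ↦ ?_⟩
  have hi := NoiseDrift.isInvertible_of_mem_orthonormalFrames hu
  rw [hY u.proj (NoiseDrift.frameBasis hi)]
  exact NoiseDrift.noiseInducedDrift_eq_horizontalLift cov hdec hσ hinv hu hi
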